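/- Let $M=\mathbb R^3$, or $M=S^3=\mathbb R^3\cup\{\infty\}$, the unit sphere of $\mathbb R^4$, where $\mathbb R^3$ is included by the inverse $\sigma$ of the stereographic projection from $(0,0,0,1)$ onto the equatorial hyperplane, i.e. $\sigma(p)=\frac{(2p,\,|p|^2-1)}{|p|^2+1}$, and $S^3$ has the orientation extending the standard one of $\mathbb R^3$. Let $u\colon M\to M$ be the involution $(x,y,z)\mapsto(x,-y,-z)$ of $\mathbb R^3$, respectively its extension $(x_0,x_1,x_2,x_3)\mapsto(x_0,-x_1,-x_2,x_3)$ to $S^3$. An invariant contact structure on $M$ is a plane field $\xi=\ker\alpha$, where $\alpha$ is a smooth $1$-form on $M$ with $\alpha\wedge d\alpha>0$ everywhere, such that $u^*\xi=\xi$ and $u^*\alpha=-\alpha$. Proposition 2.5 (EDarbouxustd). For every invariant contact structure $\xi$ on $M$ there is a smooth isotopy $(\psi_t)_{t\in[0,1]}$ of $M$ by diffeomorphisms of $M$, with $\psi_0=\mathrm{id}$ and $\psi_t\circ u=u\circ\psi_t$ for all $t\in[0,1]$, such that $T\psi_1(\xi)$ coincides with $\ker(dz-y\,dx)$ in a neighborhood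 of the origin of $\mathbb R^3$ (in the case of $S^3$: $\sigma^*(T\psi_1(\xi))=\ker(dz-y\,dx)$ in a neighborhood of the origin of $\mathbb R^3$). -/

import Mathlib

open scoped Manifold ContDiff Topology

/-- Euclidean 3-space; the coordinates `x`, `y`, `z` are those with index `0`, `1`, `2`. -/
abbrev R3 : Type := EuclideanSpace ℝ (Fin 3)

/-- The unit sphere `S³ ⊆ ℝ⁴`, with Mathlib's smooth structure. -/
abbrev S3 : Type := Metric.sphere (0 : EuclideanSpace ℝ (Fin 4)) 1

/-- Differential 1-forms (no smoothness assumed) on a 3-manifold. -/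
abbrev OneForm (M : Type*) [TopologicalSpace M] [ChartedSpace R3 M] : Type _ :=
  (p : M) → TangentSpace (𝓡 3) p →L[ℝ] ℝ

/-- Fields of tangent subspaces on a 3-manifold. -/
abbrev TangentField (M : Type*) [TopologicalSpace M] [ChartedSpace R3 M] : Type _ :=
  (p : M) → Submodule ℝ (TangentSpace (𝓡 3) p)

section General

variable {M N : Type*} [TopologicalSpace M] [ChartedSpace R3 M]
  [TopologicalSpace N] [ChartedSpace R3 N]

/-- The pull-back `f^*α` of a 1-form. -/
noncomputable def OneForm.pullback (f : M → N) (α : OneForm N) : OneForm M :=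
  fun p => (α (f p)).comp (mfderiv (𝓡 3) (𝓡 3) f p)

/-- The pull-back `f^*ξ`: a vector `v` at `p` belongs to `f^*ξ` iff `df_p v ∈ ξ_{f p}`. -/
noncomputable def TangentField.pullback (f : M → N) (ξ : TangentField N) : TangentField M :=
  fun p => (ξ (f p)).comap (mfderiv (𝓡 3) (𝓡 3) f p).toLinearMap

/-- The image `Tφ(ξ)` of `ξ` under a diffeomorphism `φ`, i.e. the pull-back of `ξ` by `φ⁻¹`. -/
noncomputable def TangentField.pushforward (φ : M ≃ₘ^∞⟮𝓡 3, 𝓡 3⟯ N) (ξ : TangentField M) :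
    TangentField N :=
  TangentField.pullback φ.symm ξ

/-- The kernel of a 1-form. -/
noncomputable def OneForm.ker (α : OneForm M) : TangentField M := fun p => LinearMap.ker (α p).toLinearMap

end General

/-- The exterior derivative of a 1-form on `ℝ³`:
`da(v, w) = ∂_v (a(w)) - ∂_w (a(v))` for constant `v`, `w`. -/
noncomputable def extDerivOne (a : R3 → R3 →L[ℝ] ℝ) (p v w : R3) : ℝ :=
  fderiv ℝ a p v w - fderiv ℝ a p w v

/-- The coefficient of `a ∧ da` with respect to `dx ∧ dy ∧ dz`, i.e. the value of `a ∧ da` on the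
standard basis of `ℝ³`. -/
noncomputable def wedgeExtDeriv (a : R3 → R3 →L[ℝ] ℝ) (p : R3) : ℝ :=
  let e : Fin 3 → R3 := fun i => EuclideanSpace.single i 1
  a p (e 0) * extDerivOne a p (e 1) (e 2) + a p (e 1) * extDerivOne a p (e 2) (e 0)
    + a p (e 2) * extDerivOne a p (e 0) (e 1)

/-- `a` is a smooth 1-form on `ℝ³` such that `a ∧ da` is everywhere positive with respect to the
standard orientation. -/
def IsPositiveContactR3 (a : R3 → R3 →L[ℝ] ℝ) : Prop :=
  ContDiff ℝ ∞ a ∧ ∀ p, 0 < wedgeExtDeriv a p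

section Contact

variable {M : Type*} [TopologicalSpace M] [ChartedSpace R3 M]

/-- Positive contact forms on a 3-manifold `M`, whose smooth structure and orientation are given by
a set `P` of parametrizations `ℝ³ → M` whose images cover `M` (the inverses of the charts of an
oriented atlas): in each of them the form is smooth and `α ∧ dα` is positive. -/
def IsPositiveContactForm (P : Set (R3 → M)) (α : OneForm M) : Prop :=
  ∀ φ ∈ P, IsPositiveContactR3 (OneForm.pullback φ α)

/-- `ξ` is a positively cooriented contact structure `ker α` which is invariant under `u`,
in the sense that `u^*ξ = ξ` and `u^*α = -α`. -/
def IsInvariantContactStructure (P : Set (R3 → M)) (u : M → M) (ξ : TangentField M) : Prop :=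
  TangentField.pullback u ξ = ξ ∧
    ∃ α : OneForm M, IsPositiveContactForm P α ∧ ξ = OneForm.ker α ∧
      ∀ p, OneForm.pullback u α p = -α p

/-- `(ψ_t)`, `t ∈ [0, 1]`, is a smooth isotopy of the whole of `M`, starting at the identity, by
diffeomorphisms that commute with `u`. (The values for `t ∉ [0, 1]` are irrelevant.) -/
structure IsEquivariantIsotopy (u : M → M) (ψ : ℝ → M ≃ₘ^∞⟮𝓡 3, 𝓡 3⟯ M) : Prop where
  smooth : ContMDiffOn (𝓘(ℝ, ℝ).prod (𝓡 3)) (𝓡 3) ∞ (fun q : ℝ × M => ψ q.1 q.2)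
    (Set.Icc (0 : ℝ) 1 ×ˢ Set.univ)
  zero : ∀ p, ψ 0 p = p
  equivariant : ∀ t ∈ Set.Icc (0 : ℝ) 1, ∀ p, ψ t (u p) = u (ψ t p)

end Contact

/-- The 1-form `dz - y dx` on `ℝ³`. -/
noncomputable def stdForm : OneForm R3 :=
  fun p => (EuclideanSpace.proj 2 - p 1 • EuclideanSpace.proj 0 : R3 →L[ℝ] ℝ)

/-- The involution `(x, y, z) ↦ (x, -y, -z)` of `ℝ³`. -/
noncomputable def rotR3 (p : R3) : R3 := !₂[p 0, -p 1, -p 2]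

/-- The oriented atlas of `ℝ³`. -/
def atlasR3 : Set (R3 → R3) := {id}

theorem mem_S3_iff (p : EuclideanSpace ℝ (Fin 4)) :
    p ∈ Metric.sphere (0 : EuclideanSpace ℝ (Fin 4)) 1 ↔
      p 0 ^ 2 + p 1 ^ 2 + p 2 ^ 2 + p 3 ^ 2 = 1 := by
  rw [mem_sphere_zero_iff_norm, EuclideanSpace.norm_eq, Real.sqrt_eq_one]
  simp [Fin.sum_univ_four]

/-- The extension `(x₀, x₁, x₂, x₃) ↦ (x₀, -x₁, -x₂, x₃)` of `rotR3` to `S³ = ℝ³ ∪ {∞}`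
(the identification is by stereographic projection from `∞ = (0, 0, 0, 1)`). -/
noncomputable def rotS3 (p : S3) : S3 :=
  ⟨!₂[p.1 0, -p.1 1, -p.1 2, p.1 3], by
    have h := (mem_S3_iff p.1).1 p.2
    rw [mem_S3_iff]
    simpa using h⟩

/-- The inclusion `ℝ³ → S³ = ℝ³ ∪ {∞}`, i.e. the inverse of the stereographic projection from
`∞ = (0, 0, 0, 1)` to the equatorial hyperplane; the origin is sent to `(0, 0, 0, -1)`. -/
noncomputable def stereoInv (p : R3) : S3 :=
  ⟨!₂[2 * p 0 / (p 0 ^ 2 + p 1 ^ 2 + p 2 ^ 2 + 1), 2 * p 1 / (p 0 ^ 2 + p 1 ^ 2 + p 2 ^ 2 + 1),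
      2 * p 2 / (p 0 ^ 2 + p 1 ^ 2 + p 2 ^ 2 + 1),
      (p 0 ^ 2 + p 1 ^ 2 + p 2 ^ 2 - 1) / (p 0 ^ 2 + p 1 ^ 2 + p 2 ^ 2 + 1)], by
    have h : p 0 ^ 2 + p 1 ^ 2 + p 2 ^ 2 + 1 ≠ 0 := by positivity
    rw [mem_S3_iff]
    simp
    field_simp
    ring⟩

/-- The inverse of the stereographic projection from `(0, 0, 0, -1)`, precomposed with
`(x, y, z) ↦ (-x, y, z)` in order to induce the same orientation of `S³` as `stereoInv`. -/
noncomputable def stereoInv' (p : R3) : S3 :=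
  ⟨!₂[-(2 * p 0) / (p 0 ^ 2 + p 1 ^ 2 + p 2 ^ 2 + 1), 2 * p 1 / (p 0 ^ 2 + p 1 ^ 2 + p 2 ^ 2 + 1),
      2 * p 2 / (p 0 ^ 2 + p 1 ^ 2 + p 2 ^ 2 + 1),
      (1 - (p 0 ^ 2 + p 1 ^ 2 + p 2 ^ 2)) / (p 0 ^ 2 + p 1 ^ 2 + p 2 ^ 2 + 1)], by
    have h : p 0 ^ 2 + p 1 ^ 2 + p 2 ^ 2 + 1 ≠ 0 := by positivity
    rw [mem_S3_iff]
    simp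
    field_simp
    ring⟩

/-- The oriented atlas of `S³ = ℝ³ ∪ {∞}`; its orientation extends that of `ℝ³`. -/
def atlasS3 : Set (R3 → S3) := {stereoInv, stereoInv'}

/-!
Straighten the line field `ker a ∩ ker dx` of an invariant contact form `a` near the origin, and
antisymmetrize a first integral of it that has differential `a` at the origin. The resulting odd
function `g` satisfies `dg = f dx + c a` with `f` odd and `c = 1` at the origin, so that
`φ = (x, f, g)` commutes with the involution and pulls `dz - y dx` back to `c a`. Positivity of
`a ∧ da` at the origin is positivity of the Jacobian determinant of `φ` there.

The differential of `φ` at the origin fixes the `x`-axis and acts on the `yz`-plane by a matrix of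
positive determinant. Such matrices form a connected set, and a map tangent to the identity can be
cut off to a small perturbation of the identity, which is isotopic to the identity along a straight
line. Hence the germ of `φ` is the time-one germ of a compactly supported equivariant isotopy
of `ℝ³`, which extends to `S³` by fixing `∞`.

The first integral comes from a smooth local flow, and that from the implicit function theorem
applied to the equation for trajectories in a space of continuous paths.
-/

universe u

section Superposition

variable {X : Type*} [TopologicalSpace X] [CompactSpace X]
  {E F : Type u} [NormedAddCommGroup E] [NormedSpace ℝ E] [NormedAddCommGroup F] [NormedSpace ℝ F]

/-- Pointwise application of a continuous family of linear maps to a continuous map, as a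
continuous bilinear map; it expresses the derivative of superposition operators. -/
noncomputable def pointwiseApply : C(X, E →L[ℝ] F) →L[ℝ] C(X, E) →L[ℝ] C(X, F) :=
  LinearMap.mkContinuous₂
    (LinearMap.mk₂ ℝ
      (fun (A : C(X, E →L[ℝ] F)) (v : C(X, E)) =>
        (⟨fun x => A x (v x), A.continuous.clm_apply v.continuous⟩ : C(X, F)))
      (fun A B v => by ext; simp) (fun c A v => by ext; simp)
      (fun A v w => by ext; simp) (fun c A v => by ext; simp)) 1
    (fun A v => by
      rw [one_mul, ContinuousMap.norm_le _ (by positivity)]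
      exact fun x => (A x).le_of_opNorm_le_of_le (A.norm_coe_le_norm x) (v.norm_coe_le_norm x))

theorem hasFDerivAt_superposition {f : E → F} (hf : ContDiff ℝ 1 f) (w : C(X, E)) :
    HasFDerivAt (fun w : C(X, E) => (ContinuousMap.mk f hf.continuous).comp w)
      (pointwiseApply ((ContinuousMap.mk (fderiv ℝ f) (hf.continuous_fderiv one_ne_zero)).comp w))
      w := by
  set f' : C(E, E →L[ℝ] F) := ⟨fderiv ℝ f, hf.continuous_fderiv one_ne_zero⟩
  rw [hasFDerivAt_iff_isLittleO_nhds_zero, Asymptotics.isLittleO_iff]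
  intro ε hε
  obtain ⟨δ, hδ, hδf'⟩ :=
    (Metric.continuous_iff (α := C(X, E)) (β := C(X, E →L[ℝ] F))).1
      (ContinuousMap.continuous_postcomp f') w ε hε
  filter_upwards [Metric.ball_mem_nhds (0 : C(X, E)) hδ] with h hh
  rw [ContinuousMap.norm_le _ (by positivity)]
  intro x
  have hseg : ∀ y ∈ segment ℝ (w x) (w x + h x), ‖fderiv ℝ f y - fderiv ℝ f (w x)‖ ≤ ε := by
    rw [segment_eq_image']
    rintro _ ⟨t, ht, rfl⟩
    have hclose : dist (w + t • h) w < δ := by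
      rw [dist_eq_norm, add_sub_cancel_left, norm_smul, Real.norm_of_nonneg ht.1]
      rw [mem_ball_zero_iff] at hh
      nlinarith [ht.2, norm_nonneg h]
    rw [add_sub_cancel_left, ← dist_eq_norm]
    exact (ContinuousMap.dist_apply_le_dist (f := f'.comp (w + t • h)) (g := f'.comp w) x).trans
      (hδf' _ hclose).le
  have hmean := (convex_segment (𝕜 := ℝ) (w x) (w x + h x)).norm_image_sub_le_of_norm_fderiv_le'
    (fun y _ => hf.differentiable one_ne_zero y) hseg
    (left_mem_segment ℝ _ _) (right_mem_segment ℝ _ _)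
  rw [add_sub_cancel_left] at hmean
  exact hmean.trans (mul_le_mul_of_nonneg_left (h.norm_coe_le_norm x) hε.le)

theorem contDiff_nat_superposition (n : ℕ) :
    ∀ {F : Type u} [NormedAddCommGroup F] [NormedSpace ℝ F] (f : C(E, F)),
      ContDiff ℝ n f → ContDiff ℝ n (fun w : C(X, E) => f.comp w) := by
  induction n with
  | zero => exact fun f _ => contDiff_zero.2 (ContinuousMap.continuous_postcomp f)
  | succ n ih =>
    intro F _ _ f hf
    have hf₁ : ContDiff ℝ 1 f := hf.of_le (by exact_mod_cast Nat.le_add_left 1 n)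
    push_cast at hf ⊢
    rw [contDiff_succ_iff_hasFDerivAt]
    exact ⟨_, pointwiseApply.contDiff.comp (ih
      ⟨fderiv ℝ f, hf₁.continuous_fderiv one_ne_zero⟩ (hf.fderiv_right le_rfl)),
      hasFDerivAt_superposition hf₁⟩

theorem contDiff_superposition {f : C(E, F)} (hf : ContDiff ℝ ∞ f) :
    ContDiff ℝ ∞ (fun w : C(X, E) => f.comp w) :=
  contDiff_infty.2 fun n => contDiff_nat_superposition n f (contDiff_infty.1 hf n)

end Superposition

section InverseFunction

variable {V W : Type*} [NormedAddCommGroup V] [NormedSpace ℝ V] [CompleteSpace V]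
  [NormedAddCommGroup W] [NormedSpace ℝ W]

theorem exists_openPartialHomeomorph_contDiffAt_symm {G : V → W} {a : V}
    (hG : ∀ᶠ v in 𝓝 a, ContDiffAt ℝ ∞ G v) (A : V ≃L[ℝ] W)
    (hA : HasFDerivAt G (A : V →L[ℝ] W) a) :
    ∃ e : OpenPartialHomeomorph V W, ⇑e = G ∧ a ∈ e.source ∧
      ∀ᶠ w in 𝓝 (G a), ContDiffAt ℝ ∞ e.symm w := by
  have hn : (∞ : WithTop ℕ∞) ≠ 0 := by simp
  have hGa := hG.self_of_nhds
  set e := hGa.toOpenPartialHomeomorph G hA hn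
  have ha : a ∈ e.source := hGa.mem_toOpenPartialHomeomorph_source hA hn
  refine ⟨e, rfl, ha, ?_⟩
  have hinv : ∀ᶠ v in 𝓝 a, fderiv ℝ G v ∈ Set.range ((↑) : (V ≃L[ℝ] W) → V →L[ℝ] W) := by
    refine (hGa.fderiv_right (m := 0) (by simp)).continuousAt.eventually ?_
    rw [hA.fderiv]
    exact A.nhds
  have htends : Filter.Tendsto e.symm (𝓝 (G a)) (𝓝 a) := by
    have h := e.continuousAt_symm (e.map_source ha)
    rwa [ContinuousAt, e.left_inv ha] at h
  filter_upwards [htends.eventually (hinv.and hG), e.open_target.mem_nhds (e.map_source ha)]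
    with w ⟨⟨B, hB⟩, hGw⟩ hw
  refine e.contDiffAt_symm (f₀' := B) hw ?_ hGw
  rw [hB]
  exact (hGw.differentiableAt hn).hasFDerivAt

end InverseFunction

section LocalFlow

variable {E : Type u} [NormedAddCommGroup E] [NormedSpace ℝ E]

/-- The integration operator `v ↦ (r ↦ ∫₀^r v)` on continuous curves on `[0, 1]`. -/
noncomputable def primitive : C(unitInterval, E) →L[ℝ] C(unitInterval, E) :=
  LinearMap.mkContinuous
    { toFun := fun v =>
        ⟨fun r => ∫ s in (0 : ℝ)..r, Set.IccExtend (zero_le_one' ℝ) v s,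
          (intervalIntegral.continuous_primitive
            (fun a b => v.continuous.Icc_extend'.intervalIntegrable a b) 0).comp
              continuous_subtype_val⟩
      map_add' := fun v w => by
        ext r
        exact intervalIntegral.integral_add (v.continuous.Icc_extend'.intervalIntegrable _ _)
          (w.continuous.Icc_extend'.intervalIntegrable _ _)
      map_smul' := fun c v => by
        ext r
        exact intervalIntegral.integral_smul c _ }
    1 (fun v => by
      rw [one_mul, ContinuousMap.norm_le _ (norm_nonneg _)]
      intro r
      refine (intervalIntegral.norm_integral_le_of_norm_le_const
        fun x _ => v.norm_coe_le_norm _).trans (mul_le_of_le_one_right (norm_nonneg _) ?_)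
      rw [sub_zero, abs_of_nonneg r.2.1]
      exact r.2.2)

/-- The operator whose zeros `((x, l), w)` are the trajectories `w r = γ (l r)` of the vector
field `f`, where `γ' = f (γ)` and `γ 0 = x`, rescaled to the time interval `[0, 1]`. -/
noncomputable def trajectoryDefect (f : C(E, E)) (s : (E × ℝ) × C(unitInterval, E)) :
    C(unitInterval, E) :=
  s.2 - (ContinuousLinearMap.const ℝ unitInterval s.1.1 + s.1.2 • primitive (f.comp s.2))

theorem trajectoryDefect_eq_zero_iff {f : C(E, E)} {q : E × ℝ} {w : C(unitInterval, E)} :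
    trajectoryDefect f (q, w) = 0 ↔
      ∀ r : unitInterval,
        w r = q.1 + q.2 • ∫ s in (0 : ℝ)..r, f (Set.IccExtend zero_le_one w s) := by
  rw [trajectoryDefect, sub_eq_zero, ContinuousMap.ext_iff]
  rfl

theorem trajectoryDefect_slowDown {f : C(E, E)} {x : E} {l : ℝ} {w : C(unitInterval, E)}
    (hw : trajectoryDefect f ((x, l), w) = 0) (c : unitInterval) :
    trajectoryDefect f ((x, c * l), w.comp ⟨fun r => c * r, by fun_prop⟩) = 0 := by
  rw [trajectoryDefect_eq_zero_iff] at hw ⊢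
  intro r
  have hext : Set.EqOn (fun s => f (Set.IccExtend (zero_le_one' ℝ)
      (w.comp ⟨fun r => c * r, by fun_prop⟩) s))
      (fun s => f (Set.IccExtend (zero_le_one' ℝ) w (c * s))) (Set.uIcc 0 r) := by
    intro s hs
    rw [Set.uIcc_of_le r.2.1] at hs
    have hs' : s ∈ Set.Icc (0 : ℝ) 1 := ⟨hs.1, hs.2.trans r.2.2⟩
    simp only [Set.IccExtend_of_mem _ _ hs', Set.IccExtend_of_mem _ _
      (unitInterval.mul_mem c.2 hs')]
    rfl
  rw [intervalIntegral.integral_congr hext, mul_comm, mul_smul,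
    intervalIntegral.smul_integral_comp_mul_left (fun s => f (Set.IccExtend zero_le_one w s)),
    mul_zero]
  exact hw (c * r)

theorem contDiff_trajectoryDefect {f : C(E, E)} (hf : ContDiff ℝ ∞ f) :
    ContDiff ℝ ∞ (trajectoryDefect f) := by
  have hsup := contDiff_superposition (X := unitInterval) hf
  unfold trajectoryDefect
  fun_prop

theorem hasFDerivAt_trajectoryDefect {f : C(E, E)} (hf : ContDiff ℝ ∞ f) (x₀ : E)
    (w₀ : C(unitInterval, E)) :
    HasFDerivAt (trajectoryDefect f)
      (.snd ℝ _ _ - ((ContinuousLinearMap.const ℝ unitInterval).comp (.fst ℝ E ℝ) +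
        (ContinuousLinearMap.snd ℝ E ℝ).smulRight (primitive (f.comp w₀))).comp (.fst ℝ _ _))
      ((x₀, 0), w₀) := by
  have hint : DifferentiableAt ℝ (fun s : (E × ℝ) × C(unitInterval, E) =>
      primitive (f.comp s.2)) ((x₀, 0), w₀) := by
    have hsup := (contDiff_superposition (X := unitInterval) hf).differentiable (by simp)
    fun_prop
  have hx := ((ContinuousLinearMap.const ℝ unitInterval (M := E)).comp
    ((ContinuousLinearMap.fst ℝ E ℝ).comp (.fst ℝ (E × ℝ) C(unitInterval, E)))).hasFDerivAt
      (x := ((x₀, 0), w₀))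
  have hl := ((ContinuousLinearMap.snd ℝ E ℝ).comp
    (.fst ℝ (E × ℝ) C(unitInterval, E))).hasFDerivAt (x := ((x₀, 0), w₀))
  refine (hasFDerivAt_snd.sub (hx.add (hl.smul hint.hasFDerivAt))).congr_fderiv ?_
  ext <;> simp

variable [CompleteSpace E]

theorem exists_contDiffAt_trajectory {f : C(E, E)} (hf : ContDiff ℝ ∞ f) (x₀ : E) :
    ∃ U : E × ℝ → C(unitInterval, E), U (x₀, 0) = ContinuousMap.const _ x₀ ∧
      (∀ᶠ q in 𝓝 (x₀, (0 : ℝ)), ContDiffAt ℝ ∞ U q ∧ trajectoryDefect f (q, U q) = 0) ∧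
      ∀ᶠ s in 𝓝 ((x₀, (0 : ℝ)), ContinuousMap.const unitInterval x₀),
        trajectoryDefect f s = 0 → s.2 = U s.1 := by
  set w₀ := ContinuousMap.const unitInterval x₀
  have hG : ContDiff ℝ ∞ fun s => (s.1, trajectoryDefect f s) :=
    contDiff_fst.prodMk (contDiff_trajectoryDefect hf)
  have hG' : HasFDerivAt (fun s => (s.1, trajectoryDefect f s))
      ((ContinuousLinearEquiv.refl ℝ (E × ℝ)).skewProd (.refl ℝ C(unitInterval, E))
        (-((ContinuousLinearMap.const ℝ unitInterval).comp (.fst ℝ E ℝ) +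
        (ContinuousLinearMap.snd ℝ E ℝ).smulRight (primitive (f.comp w₀)))) : _ →L[ℝ] _)
      ((x₀, 0), w₀) := by
    refine (hasFDerivAt_fst.prodMk (hasFDerivAt_trajectoryDefect hf x₀ w₀)).congr_fderiv ?_
    ext <;> simp [sub_eq_add_neg]
  obtain ⟨e, he, hmem, hsymm⟩ := exists_openPartialHomeomorph_contDiffAt_symm
    (.of_forall fun _ => hG.contDiffAt) _ hG'
  replace he : ∀ s, e s = (s.1, trajectoryDefect f s) := congrFun he
  have hew₀ : e ((x₀, 0), w₀) = ((x₀, 0), 0) := by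
    rw [he, trajectoryDefect_eq_zero_iff.2]
    simp [w₀]
  have hslice : ContDiff ℝ ∞ fun q : E × ℝ => (q, (0 : C(unitInterval, E))) :=
    contDiff_id.prodMk contDiff_const
  rw [← he, hew₀] at hsymm
  refine ⟨fun q => (e.symm (q, 0)).2, ?_, ?_, ?_⟩
  · simp only [← hew₀, e.left_inv hmem]
  · have htarget := e.open_target.mem_nhds (hew₀ ▸ e.map_source hmem)
    filter_upwards [hslice.continuous.continuousAt.eventually hsymm,
      hslice.continuous.continuousAt.eventually htarget] with q hq hqt
    have hright := e.right_inv hqt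
    rw [he] at hright
    refine ⟨contDiff_snd.contDiffAt.comp q (hq.comp q hslice.contDiffAt), ?_⟩
    have hfst : (e.symm (q, 0)).1 = q := congrArg Prod.fst hright
    have hsnd : trajectoryDefect f (e.symm (q, 0)) = 0 := congrArg Prod.snd hright
    rwa [← Prod.mk.eta (p := e.symm (q, 0)), hfst] at hsnd
  · filter_upwards [e.open_source.mem_nhds hmem] with s hs hsw
    rw [← hsw, ← he, e.left_inv hs]

theorem exists_contDiffAt_trajectory_slowDown {f : C(E, E)} (hf : ContDiff ℝ ∞ f) (x₀ : E) :
    ∃ U : E × ℝ → C(unitInterval, E), ∀ᶠ q in 𝓝 (x₀, (0 : ℝ)),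
      ContDiffAt ℝ ∞ U q ∧ trajectoryDefect f (q, U q) = 0 ∧
        ∀ c : unitInterval, U q c = U (q.1, c * q.2) 1 := by
  obtain ⟨U, hU₀, hU, hunique⟩ := exists_contDiffAt_trajectory hf x₀
  refine ⟨U, ?_⟩
  obtain ⟨ε, hε, hball⟩ := Metric.eventually_nhds_iff_ball.1 hunique
  have hUcont := hU.self_of_nhds.1.continuousAt
  rw [ContinuousAt, hU₀] at hUcont
  filter_upwards [hU, hUcont.eventually (Metric.ball_mem_nhds _ hε), Metric.ball_mem_nhds _ hε]
    with q ⟨hsmooth, hq⟩ hUq hqε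
  refine ⟨hsmooth, hq, fun c => ?_⟩
  have hmem : ((q.1, c * q.2), (U q).comp ⟨fun r => c * r, by fun_prop⟩) ∈
      Metric.ball ((x₀, (0 : ℝ)), ContinuousMap.const unitInterval x₀) ε := by
    rw [← ball_prod_same, ← ball_prod_same]
    rw [← ball_prod_same] at hqε
    refine ⟨⟨hqε.1, Metric.mem_ball.2 (lt_of_le_of_lt ?_ hqε.2)⟩,
      Metric.mem_ball.2 (lt_of_le_of_lt ?_ hUq)⟩
    · simp only
      rw [Real.dist_0_eq_abs, Real.dist_0_eq_abs, abs_mul, abs_of_nonneg c.2.1]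
      exact mul_le_of_le_one_left (abs_nonneg _) c.2.2
    · exact (ContinuousMap.dist_le dist_nonneg).2 fun r =>
        ContinuousMap.dist_apply_le_dist (f := U q) (g := .const _ x₀) (c * r)
  have hcurve := hball _ hmem (trajectoryDefect_slowDown hq c)
  simpa using congrArg (fun w => w 1) hcurve

theorem hasDerivAt_integral_of_continuousOn_Ioo {g : ℝ → E} {ε t : ℝ}
    (hg : ContinuousOn g (Set.Ioo (-ε) ε)) (ht : t ∈ Set.Ioo (-ε) ε) :
    HasDerivAt (fun t => ∫ s in (0 : ℝ)..t, g s) (g t) t := by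
  have h₀ : (0 : ℝ) ∈ Set.Ioo (-ε) ε := by constructor <;> linarith [ht.1, ht.2]
  exact intervalIntegral.integral_hasDerivAt_right
    (hg.mono (Set.ordConnected_Ioo.uIcc_subset h₀ ht)).intervalIntegrable
    (hg.stronglyMeasurableAtFilter isOpen_Ioo t ht) (hg.continuousAt (isOpen_Ioo.mem_nhds ht))

theorem exists_contDiffAt_localFlow {f : E → E} (hf : ContDiff ℝ ∞ f) (x₀ : E) :
    ∃ Φ : E × ℝ → E, ∀ᶠ q in 𝓝 (x₀, (0 : ℝ)), ContDiffAt ℝ ∞ Φ q ∧ Φ (q.1, 0) = q.1 ∧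
      HasDerivAt (fun t => Φ (q.1, t)) (f (Φ q)) q.2 := by
  obtain ⟨U, hU⟩ := exists_contDiffAt_trajectory_slowDown (f := ⟨f, hf.continuous⟩) hf x₀
  obtain ⟨ε, hε, hball⟩ := Metric.eventually_nhds_iff_ball.1 hU
  set Φ : E × ℝ → E := fun q => U q 1
  have hΦ : ∀ q ∈ Metric.ball (x₀, (0 : ℝ)) ε, ContDiffAt ℝ ∞ Φ q := fun q hq =>
    (ContinuousMap.evalCLM ℝ (1 : unitInterval) : C(unitInterval, E) →L[ℝ] E)
      |>.contDiff.contDiffAt.comp q (hball q hq).1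
  have hint : ∀ q ∈ Metric.ball (x₀, (0 : ℝ)) ε,
      Φ q = q.1 + ∫ s in (0 : ℝ)..q.2, f (Φ (q.1, s)) := by
    intro q hq
    have hcongr : Set.EqOn (fun s => f (Set.IccExtend zero_le_one (U q) s))
        (fun s => f (Φ (q.1, q.2 * s))) (Set.uIcc 0 1) := by
      intro s hs
      rw [Set.uIcc_of_le zero_le_one] at hs
      simp only [Set.IccExtend_of_mem _ _ hs, (hball q hq).2.2 ⟨s, hs⟩, Φ, mul_comm]
    refine (trajectoryDefect_eq_zero_iff.1 (hball q hq).2.1 1).trans ?_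
    simp only [ContinuousMap.coe_mk, Set.Icc.coe_one]
    rw [intervalIntegral.integral_congr hcongr,
      intervalIntegral.smul_integral_comp_mul_left (fun s => f (Φ (q.1, s))), mul_zero, mul_one]
  refine ⟨Φ, Filter.eventually_of_mem (Metric.ball_mem_nhds _ hε) fun q hq => ?_⟩
  have hline : ∀ t ∈ Set.Ioo (-ε) ε, (q.1, t) ∈ Metric.ball (x₀, (0 : ℝ)) ε := by
    rw [← ball_prod_same] at hq ⊢
    exact fun t ht => ⟨hq.1, by simpa [Real.dist_0_eq_abs, abs_lt] using ht⟩
  have hq2 : q.2 ∈ Set.Ioo (-ε) ε := by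
    rw [← ball_prod_same] at hq
    simpa [Real.dist_0_eq_abs, abs_lt] using hq.2
  have hcont : ContinuousOn (fun t => f (Φ (q.1, t))) (Set.Ioo (-ε) ε) := fun t ht =>
    (hf.continuous.continuousAt.comp ((hΦ _ (hline t ht)).continuousAt.comp
      (Continuous.prodMk_right q.1).continuousAt)).continuousWithinAt
  refine ⟨hΦ q hq, ?_, ?_⟩
  · simpa using hint (q.1, 0) (hline 0 ⟨neg_lt_zero.2 hε, hε⟩)
  · refine ((hasDerivAt_integral_of_continuousOn_Ioo hcont hq2).const_add q.1).congr_of_eventuallyEq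
      (Filter.eventually_of_mem (isOpen_Ioo.mem_nhds hq2) fun t ht => hint _ (hline t ht))

end LocalFlow

section FirstIntegral

variable {E : Type u} [NormedAddCommGroup E] [NormedSpace ℝ E] [CompleteSpace E]

/-- The map `y ↦ Φ (x₀ + y - m y • V x₀, m y)` built from the flow `Φ` of `V` straightens `V`. -/
theorem exists_straightening_symm {V : E → E} (hV : ContDiff ℝ ∞ V) {x₀ : E} (hV₀ : V x₀ ≠ 0) :
    ∃ Ψ : E → E, Ψ 0 = x₀ ∧ fderiv ℝ Ψ 0 = .id ℝ E ∧
      ∀ᶠ y in 𝓝 0, ContDiffAt ℝ ∞ Ψ y ∧ fderiv ℝ Ψ y (V x₀) = V (Ψ y) := by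
  obtain ⟨Φ, hΦ⟩ := exists_contDiffAt_localFlow hV x₀
  obtain ⟨m, hm⟩ := SeparatingDual.exists_eq_one (R := ℝ) hV₀
  set T : E → E × ℝ := fun y => (x₀ + (y - m y • V x₀), m y)
  have hT : ContDiff ℝ ∞ T := by fun_prop
  have hT₀ : T 0 = (x₀, 0) := by simp [T]
  have hTline (y : E) (t : ℝ) : T (y + t • V x₀) = ((T y).1, (T y).2 + t) := by
    simp only [T, map_add, map_smul, hm, smul_eq_mul, mul_one, add_smul]
    congr 2
    abel
  have hΨ : ∀ᶠ y in 𝓝 0, ContDiffAt ℝ ∞ (Φ ∘ T) y ∧ fderiv ℝ (Φ ∘ T) y (V x₀) = V (Φ (T y)) := by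
    filter_upwards [hT.continuous.continuousAt.eventually (hT₀ ▸ hΦ)] with y hy
    have hsmooth := hy.1.comp y hT.contDiffAt
    refine ⟨hsmooth, ?_⟩
    rw [← (hsmooth.differentiableAt (by simp)).lineDeriv_eq_fderiv]
    refine HasLineDerivAt.lineDeriv ?_
    have hderiv := hy.2.2.scomp_of_eq (0 : ℝ) ((hasDerivAt_id (0 : ℝ)).const_add (T y).2)
      (by simp)
    simpa [HasLineDerivAt, Function.comp_def, hTline] using hderiv
  have hfix : ∀ᶠ y in 𝓝 (x₀, (0 : ℝ)), Φ (y.1, 0) = y.1 := hΦ.mono fun y hy => hy.2.1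
  have hΨ₀ : Φ (T 0) = x₀ := hT₀ ▸ hfix.self_of_nhds
  refine ⟨Φ ∘ T, hΨ₀, ?_, hΨ⟩
  have hker : ∀ y, m y = 0 → fderiv ℝ (Φ ∘ T) 0 y = y := by
    intro y hy
    rw [← (hΨ.self_of_nhds.1.differentiableAt (by simp)).lineDeriv_eq_fderiv]
    refine HasLineDerivAt.lineDeriv ?_
    have hline : Filter.Tendsto (fun t : ℝ => (x₀ + t • y, (0 : ℝ))) (𝓝 0) (𝓝 (x₀, 0)) := by
      have hc : Continuous fun t : ℝ => (x₀ + t • y, (0 : ℝ)) := by fun_prop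
      simpa using hc.tendsto 0
    refine HasDerivAt.congr_of_eventuallyEq (f₁ := fun t => (Φ ∘ T) (0 + t • y))
      (((hasDerivAt_id (0 : ℝ)).smul_const y).const_add x₀ |>.congr_deriv (one_smul ℝ y)) ?_
    filter_upwards [hline.eventually hfix] with t ht
    simpa [T, hy] using ht
  ext y
  have hsplit := hker (y - m y • V x₀) (by simp [hm])
  rw [map_sub, map_smul, hΨ.self_of_nhds.2, hΨ₀] at hsplit
  exact sub_left_injective hsplit

theorem exists_straightening {V : E → E} (hV : ContDiff ℝ ∞ V) {x₀ : E} (hV₀ : V x₀ ≠ 0) :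
    ∃ S : E → E, HasFDerivAt S (.id ℝ E) x₀ ∧
      ∀ᶠ p in 𝓝 x₀, ContDiffAt ℝ ∞ S p ∧ fderiv ℝ S p (V p) = V x₀ := by
  obtain ⟨Ψ, hΨ₀, hΨ', hΨ⟩ := exists_straightening_symm hV hV₀
  have hdiff : HasFDerivAt Ψ (ContinuousLinearEquiv.refl ℝ E : E →L[ℝ] E) 0 :=
    (hΨ.self_of_nhds.1.differentiableAt (by simp)).hasFDerivAt.congr_fderiv hΨ'
  obtain ⟨e, rfl, hmem, hsymm⟩ :=
    exists_openPartialHomeomorph_contDiffAt_symm (hΨ.mono fun _ hy => hy.1) _ hdiff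
  have hx₀ := e.map_source hmem
  have hS₀ := e.left_inv hmem
  rw [hΨ₀] at hsymm hx₀ hS₀
  have htends := e.continuousAt_symm hx₀
  rw [ContinuousAt, hS₀] at htends
  refine ⟨e.symm, e.hasFDerivAt_symm (f' := .refl ℝ E) hx₀ (by rwa [hS₀]), ?_⟩
  filter_upwards [hsymm, e.open_target.mem_nhds hx₀, htends.eventually hΨ]
    with p hp hpt ⟨hy, hyV⟩
  refine ⟨hp, ?_⟩
  rw [e.right_inv hpt] at hyV
  have hdS : HasFDerivAt e.symm (fderiv ℝ e.symm p) (e (e.symm p)) := by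
    rw [e.right_inv hpt]
    exact (hp.differentiableAt (by simp)).hasFDerivAt
  have hcomp := hdS.comp (e.symm p) (hy.differentiableAt (by simp)).hasFDerivAt
  have hid : e.symm ∘ e =ᶠ[𝓝 (e.symm p)] id := by
    filter_upwards [e.open_source.mem_nhds (e.map_target hpt)] with y hy using e.left_inv hy
  have heq := hcomp.unique (hid.hasFDerivAt_iff.2 (hasFDerivAt_id _))
  rw [← hyV]
  exact DFunLike.congr_fun heq (V x₀)

theorem exists_firstIntegral {V : E → E} (hV : ContDiff ℝ ∞ V) {x₀ : E} (hV₀ : V x₀ ≠ 0)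
    {ℓ : E →L[ℝ] ℝ} (hℓ : ℓ (V x₀) = 0) :
    ∃ g : E → ℝ, fderiv ℝ g x₀ = ℓ ∧
      ∀ᶠ p in 𝓝 x₀, ContDiffAt ℝ ∞ g p ∧ fderiv ℝ g p (V p) = 0 := by
  obtain ⟨S, hS₀, hS⟩ := exists_straightening hV hV₀
  refine ⟨ℓ ∘ S, (ℓ.hasFDerivAt.comp x₀ hS₀).fderiv, hS.mono fun p ⟨hp, hpV⟩ => ?_⟩
  refine ⟨ℓ.contDiff.contDiffAt.comp p hp, ?_⟩
  rw [(ℓ.hasFDerivAt.comp p (hp.differentiableAt (by simp)).hasFDerivAt).fderiv]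
  simp [hpV, hℓ]

/-- A first integral `g` may be replaced by `(g - g ∘ u) / 2`. -/
theorem exists_odd_firstIntegral {V : E → E} (hV : ContDiff ℝ ∞ V) (hV₀ : V 0 ≠ 0)
    {u : E ≃L[ℝ] E} (hu : ∀ p, u (u p) = p) (hVu : ∀ᶠ p in 𝓝 0, V (u p) = -u (V p))
    {ℓ : E →L[ℝ] ℝ} (hℓ : ℓ (V 0) = 0) (hℓu : ∀ v, ℓ (u v) = -ℓ v) :
    ∃ g : E → ℝ, fderiv ℝ g 0 = ℓ ∧ (∀ p, g (u p) = -g p) ∧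
      ∀ᶠ p in 𝓝 0, ContDiffAt ℝ ∞ g p ∧ fderiv ℝ g p (V p) = 0 := by
  obtain ⟨g, hg₀, hg⟩ := exists_firstIntegral hV hV₀ hℓ
  have htends : Filter.Tendsto u (𝓝 0) (𝓝 0) := by simpa using u.continuous.tendsto 0
  have hderiv : ∀ᶠ p in 𝓝 0, HasFDerivAt (fun p => (1 / 2 : ℝ) * (g p - g (u p)))
      ((1 / 2 : ℝ) • (fderiv ℝ g p - (fderiv ℝ g (u p)).comp (u : E →L[ℝ] E))) p := by
    filter_upwards [hg, htends.eventually hg] with p hp hup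
    exact ((hp.1.differentiableAt (by simp)).hasFDerivAt.sub
      ((hup.1.differentiableAt (by simp)).hasFDerivAt.comp p u.hasFDerivAt)).const_mul _
  refine ⟨fun p => (1 / 2 : ℝ) * (g p - g (u p)), ?_, fun p => ?_, ?_⟩
  · rw [hderiv.self_of_nhds.fderiv, map_zero, hg₀]
    ext v
    simp only [smul_apply, sub_apply, ContinuousLinearMap.comp_apply,
      ContinuousLinearEquiv.coe_coe, hℓu, smul_eq_mul]
    ring
  · simp only [hu]
    ring
  · filter_upwards [hderiv, hg, htends.eventually hg, hVu] with p hp hgp hgup hVp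
    refine ⟨contDiffAt_const.mul (hgp.1.sub (hgup.1.comp p u.contDiff.contDiffAt)), ?_⟩
    have huV : u (V p) = -V (u p) := by rw [hVp, neg_neg]
    rw [hp.fderiv]
    simp [hgp.2, huV, hgup.2]

end FirstIntegral

theorem exists_ball_three_mul_forall_of_eventually {E : Type*} [NormedAddCommGroup E]
    {P : E → Prop} (h : ∀ᶠ p in 𝓝 0, P p) : ∃ ε > 0, ∀ p ∈ Metric.ball (0 : E) (3 * ε), P p := by
  obtain ⟨δ, hδ, H⟩ := Metric.eventually_nhds_iff_ball.1 h
  exact ⟨δ / 3, by positivity, by rwa [mul_div_cancel₀ δ three_ne_zero]⟩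

section Cutoff

variable {E F : Type*} [NormedAddCommGroup E] [InnerProductSpace ℝ E]
  [NormedAddCommGroup F] [NormedSpace ℝ F]

/-- A smooth radial cut-off function at scale `ε`: it is `1` on the ball of radius `ε` about the
origin and `0` outside the ball of radius `2ε`. -/
noncomputable def radialCutoff (ε : ℝ) (p : E) : ℝ :=
  Real.smoothTransition (2 - ‖ε⁻¹ • p‖ ^ 2)

theorem contDiff_radialCutoff (ε : ℝ) : ContDiff ℝ ∞ (radialCutoff ε : E → ℝ) :=
  Real.smoothTransition.contDiff.comp
    (contDiff_const.sub ((contDiff_norm_sq ℝ).comp (contDiff_const_smul ε⁻¹)))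

theorem radialCutoff_of_norm_le {ε : ℝ} (hε : 0 < ε) {p : E} (hp : ‖p‖ ≤ ε) :
    radialCutoff ε p = 1 := by
  refine Real.smoothTransition.one_of_one_le ?_
  have h : ‖ε⁻¹ • p‖ ≤ 1 := by
    rw [norm_smul, norm_inv, Real.norm_of_nonneg hε.le, inv_mul_le_iff₀ hε]
    simpa using hp
  nlinarith [norm_nonneg (ε⁻¹ • p)]

theorem radialCutoff_of_le_norm {ε : ℝ} (hε : 0 < ε) {p : E} (hp : 2 * ε ≤ ‖p‖) :
    radialCutoff ε p = 0 := by
  refine Real.smoothTransition.zero_of_nonpos ?_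
  have h : 2 ≤ ‖ε⁻¹ • p‖ := by
    rw [norm_smul, norm_inv, Real.norm_of_nonneg hε.le, le_inv_mul_iff₀ hε]
    linarith
  nlinarith

theorem abs_radialCutoff_le_one (ε : ℝ) (p : E) : |radialCutoff ε p| ≤ 1 := by
  rw [radialCutoff, abs_of_nonneg (Real.smoothTransition.nonneg _)]
  exact Real.smoothTransition.le_one _

theorem radialCutoff_linearIsometry (ε : ℝ) (u : E →ₗᵢ[ℝ] E) (p : E) :
    radialCutoff ε (u p) = radialCutoff ε p := by
  simp [radialCutoff, norm_smul]

theorem radialCutoff_eventually_eq_one {ε : ℝ} (hε : 0 < ε) :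
    ∀ᶠ p in 𝓝 (0 : E), radialCutoff ε p = 1 := by
  filter_upwards [Metric.ball_mem_nhds 0 hε] with p hp
  exact radialCutoff_of_norm_le hε (mem_ball_zero_iff.1 hp).le

theorem exists_forall_lipschitzWith_radialCutoff [FiniteDimensional ℝ E] :
    ∃ K : NNReal, ∀ ε : NNReal, LipschitzWith (K * ε⁻¹) (radialCutoff ε : E → ℝ) := by
  have hsupp : HasCompactSupport (radialCutoff 1 : E → ℝ) :=
    HasCompactSupport.intro (isCompact_closedBall 0 2) fun p hp => by
      rw [mem_closedBall_zero_iff, not_le] at hp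
      exact radialCutoff_of_le_norm one_pos (by simpa using hp.le)
  obtain ⟨K, hK⟩ := (contDiff_radialCutoff 1).lipschitzWith_of_hasCompactSupport hsupp (by simp)
  refine ⟨K, fun ε => ?_⟩
  have hscale : (radialCutoff ε : E → ℝ) = radialCutoff 1 ∘ fun p => (ε : ℝ)⁻¹ • p := by
    ext p
    simp [radialCutoff]
  have hnorm : ‖(ε : ℝ)⁻¹‖₊ = ε⁻¹ := by simp
  rw [hscale, ← hnorm]
  exact hK.comp (lipschitzWith_smul (ε : ℝ)⁻¹)

theorem contDiff_radialCutoff_smul {f : E → F} {ε : ℝ} (hε : 0 < ε)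
    (hf : ∀ p ∈ Metric.ball (0 : E) (3 * ε), ContDiffAt ℝ ∞ f p) :
    ContDiff ℝ ∞ fun p => radialCutoff ε p • f p := by
  rw [contDiff_iff_contDiffAt]
  intro p
  by_cases hp : p ∈ Metric.ball 0 (3 * ε)
  · exact (contDiff_radialCutoff ε).contDiffAt.smul (hf p hp)
  · rw [mem_ball_zero_iff, not_lt] at hp
    have hfar : ∀ᶠ q in 𝓝 p, 2 * ε < ‖q‖ :=
      continuous_norm.continuousAt.eventually (lt_mem_nhds (by linarith))
    refine (contDiffAt_const (c := (0 : F))).congr_of_eventuallyEq ?_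
    filter_upwards [hfar] with q hq
    rw [radialCutoff_of_le_norm hε hq.le, zero_smul]

theorem exists_contDiff_eventuallyEq {f : E → F} (hf : ∀ᶠ p in 𝓝 0, ContDiffAt ℝ ∞ f p) :
    ∃ g : E → F, ContDiff ℝ ∞ g ∧ g =ᶠ[𝓝 0] f := by
  obtain ⟨ε, hε, h⟩ := exists_ball_three_mul_forall_of_eventually hf
  refine ⟨_, contDiff_radialCutoff_smul hε h, ?_⟩
  filter_upwards [radialCutoff_eventually_eq_one hε] with p hp
  rw [hp, one_smul]

end Cutoff

section CutoffLipschitz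

variable {E F : Type*} [NormedAddCommGroup E] [NormedAddCommGroup F] [NormedSpace ℝ F]

theorem norm_sub_smul_le_of_lipschitz {χ : E → ℝ} {k : E → F} {K c r : NNReal}
    (hχ : LipschitzWith K χ) (hk : LipschitzOnWith c k (Metric.ball 0 r)) (hk_zero : k 0 = 0)
    {p : E} (hp : p ∈ Metric.ball 0 (r : ℝ)) (q : E) :
    ‖(χ p - χ q) • k p‖ ≤ c * (K * r) * ‖p - q‖ := by
  have hp' : ‖p‖ < r := mem_ball_zero_iff.1 hp
  have hbound : ‖k p‖ ≤ c * r := by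
    have h := hk.norm_sub_le hp (Metric.mem_ball_self ((norm_nonneg p).trans_lt hp'))
    rw [hk_zero, sub_zero, sub_zero] at h
    exact h.trans (by gcongr)
  calc
    ‖(χ p - χ q) • k p‖ ≤ (K * ‖p - q‖) * (c * r) := by
      rw [norm_smul]
      exact mul_le_mul (hχ.norm_sub_le p q) hbound (norm_nonneg _) (by positivity)
    _ = c * (K * r) * ‖p - q‖ := by ring

theorem lipschitzWith_cutoff_smul {χ : E → ℝ} {k : E → F} {K c r : NNReal}
    (hχ : LipschitzWith K χ) (hχ_one : ∀ p, |χ p| ≤ 1) (hχ_zero : ∀ p, r ≤ ‖p‖ → χ p = 0)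
    (hk : LipschitzOnWith c k (Metric.ball 0 r)) (hk_zero : k 0 = 0) :
    LipschitzWith (c * (1 + K * r)) fun p => χ p • k p := by
  have hball : ∀ p ∈ Metric.ball (0 : E) r, ∀ q,
      ‖χ p • k p - χ q • k q‖ ≤ c * (1 + K * r) * ‖p - q‖ := by
    intro p hp q
    by_cases hq : q ∈ Metric.ball 0 (r : ℝ)
    · calc ‖χ p • k p - χ q • k q‖ = ‖(χ p - χ q) • k p + χ q • (k p - k q)‖ := by
            congr 1
            module
        _ ≤ ‖(χ p - χ q) • k p‖ + |χ q| * ‖k p - k q‖ := by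
            rw [← Real.norm_eq_abs, ← norm_smul]
            exact norm_add_le _ _
        _ ≤ c * (K * r) * ‖p - q‖ + c * ‖p - q‖ :=
            add_le_add (norm_sub_smul_le_of_lipschitz hχ hk hk_zero hp q)
              ((mul_le_of_le_one_left (norm_nonneg _) (hχ_one q)).trans (hk.norm_sub_le hp hq))
        _ = c * (1 + K * r) * ‖p - q‖ := by ring
    · have hq_zero : χ q = 0 := hχ_zero q (by simpa using hq)
      have h := norm_sub_smul_le_of_lipschitz hχ hk hk_zero hp q
      rw [hq_zero, sub_zero] at h
      rw [hq_zero, zero_smul, sub_zero]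
      exact h.trans (by gcongr; linarith)
  refine LipschitzWith.of_dist_le_mul fun p q => ?_
  rw [dist_eq_norm, dist_eq_norm]
  push_cast
  by_cases hp : p ∈ Metric.ball 0 (r : ℝ)
  · exact hball p hp q
  · by_cases hq : q ∈ Metric.ball 0 (r : ℝ)
    · rw [norm_sub_rev, norm_sub_rev p]
      exact hball q hq p
    · rw [hχ_zero p (by simpa using hp), hχ_zero q (by simpa using hq)]
      simp only [zero_smul, sub_self, norm_zero]
      positivity

end CutoffLipschitz

section IsotopyGerm

theorem exists_diffeomorph_id_add {h : R3 → R3} (hs : ContDiff ℝ ∞ h)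
    (hl : LipschitzWith (1 / 2) h) :
    ∃ D : R3 ≃ₘ^∞⟮𝓡 3, 𝓡 3⟯ R3, ∀ p, D p = p + h p := by
  have happ : ApproximatesLinearOn (fun p => p + h p)
      ((ContinuousLinearEquiv.refl ℝ R3 : R3 ≃L[ℝ] R3) : R3 →L[ℝ] R3) Set.univ (1 / 2) := by
    intro x _ y _
    change ‖(x + h x) - (y + h y) - (x - y)‖ ≤ _
    rw [add_sub_add_comm, add_sub_cancel_left]
    exact hl.norm_sub_le x y
  have hhalf : Subsingleton R3 ∨ (1 / 2 : NNReal) <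
      ‖((ContinuousLinearEquiv.refl ℝ R3).symm : R3 →L[ℝ] R3)‖₊⁻¹ := by
    have hnorm : ‖((ContinuousLinearEquiv.refl ℝ R3).symm : R3 →L[ℝ] R3)‖₊ = 1 := by simp
    rw [hnorm]
    exact Or.inr (by norm_num)
  set H := happ.toHomeomorph _ hhalf
  have hsH : ContDiff ℝ ∞ H := contDiff_id.add hs
  have hderiv : ∀ p, ∃ B : R3 ≃L[ℝ] R3, HasFDerivAt H (B : R3 →L[ℝ] R3) p := by
    intro p
    have hn : ‖-fderiv ℝ h p‖ < 1 := by
      rw [norm_neg]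
      exact (norm_fderiv_le_of_lipschitz ℝ hl).trans_lt (by norm_num)
    refine ⟨ContinuousLinearEquiv.unitsEquiv ℝ R3 (Units.oneSub _ hn), ?_⟩
    refine ((hasFDerivAt_id p).add (hs.differentiable (by simp) p).hasFDerivAt).congr_fderiv ?_
    ext v
    simp
  choose B hB using hderiv
  exact ⟨{ toEquiv := H.toEquiv
           contMDiff_toFun := hsH.contMDiff
           contMDiff_invFun := (H.contDiff_symm hB hsH).contMDiff }, fun _ => rfl⟩

theorem contMDiffOn_prod_iff_contDiffOn {f : ℝ × R3 → R3} {s : Set (ℝ × R3)} :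
    ContMDiffOn (𝓘(ℝ, ℝ).prod (𝓡 3)) (𝓡 3) ∞ f s ↔ ContDiffOn ℝ ∞ f s := by
  rw [← modelWithCornersSelf_prod, chartedSpaceSelf_prod, contMDiffOn_iff_contDiffOn]

/-- `φ` agrees near the origin with the time-one map of a compactly supported `u`-equivariant
isotopy of `ℝ³`. -/
def IsIsotopyGerm (u φ : R3 → R3) : Prop :=
  ∃ ψ : ℝ → R3 ≃ₘ^∞⟮𝓡 3, 𝓡 3⟯ R3, IsEquivariantIsotopy u ψ ∧
    (∃ R : ℝ, ∀ t p, R ≤ ‖p‖ → ψ t p = p) ∧ ψ 1 =ᶠ[𝓝 0] φ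

theorem IsIsotopyGerm.congr {u φ φ' : R3 → R3} (h : IsIsotopyGerm u φ) (hφ : φ =ᶠ[𝓝 0] φ') :
    IsIsotopyGerm u φ' := by
  obtain ⟨ψ, hψ, hsupp, hφψ⟩ := h
  exact ⟨ψ, hψ, hsupp, hφψ.trans hφ⟩

theorem IsIsotopyGerm.comp {u φ φ' : R3 → R3} (h : IsIsotopyGerm u φ) (h' : IsIsotopyGerm u φ')
    (hc : Filter.Tendsto φ' (𝓝 0) (𝓝 0)) : IsIsotopyGerm u (φ ∘ φ') := by
  obtain ⟨ψ, hψ, ⟨R, hR⟩, hφ⟩ := h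
  obtain ⟨ψ', hψ', ⟨R', hR'⟩, hφ'⟩ := h'
  refine ⟨fun t => (ψ' t).trans (ψ t), ⟨?_, fun p => ?_, fun t ht p => ?_⟩,
    ⟨max R R', fun t p hp => ?_⟩, ?_⟩
  · have hs := contMDiffOn_prod_iff_contDiffOn.1 hψ.smooth
    have hs' := contMDiffOn_prod_iff_contDiffOn.1 hψ'.smooth
    exact contMDiffOn_prod_iff_contDiffOn.2
      (hs.comp (contDiff_fst.contDiffOn.prodMk hs') fun q hq => ⟨hq.1, Set.mem_univ _⟩)
  · simp [hψ.zero, hψ'.zero]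
  · simp [hψ.equivariant t ht, hψ'.equivariant t ht]
  · simp [hR' t p ((le_max_right _ _).trans hp), hR t p ((le_max_left _ _).trans hp)]
  · filter_upwards [hφ', hc.eventually hφ] with p hp hp'
    simp [hp, hp']

variable {u : R3 →ₗᵢ[ℝ] R3}

theorem isIsotopyGerm_id_add {h : R3 → R3} (hs : ContDiff ℝ ∞ h) (hl : LipschitzWith (1 / 2) h)
    (hu : ∀ p, h (u p) = u (h p)) {R : ℝ} (hR : ∀ p, R ≤ ‖p‖ → h p = 0) :
    IsIsotopyGerm u fun p => p + h p := by
  let c : ℝ → ℝ := fun t => Set.projIcc 0 1 zero_le_one t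
  have hc : ∀ t ∈ Set.Icc (0 : ℝ) 1, c t = t := fun t ht => by
    simp only [c, Set.projIcc_of_mem zero_le_one ht]
  have hD : ∀ t : ℝ, ∃ D : R3 ≃ₘ^∞⟮𝓡 3, 𝓡 3⟯ R3, ∀ p, D p = p + c t • h p := by
    intro t
    have ht : c t ∈ Set.Icc (0 : ℝ) 1 := (Set.projIcc 0 1 zero_le_one t).2
    refine exists_diffeomorph_id_add (h := fun p => c t • h p) (hs.const_smul _)
      (LipschitzWith.of_dist_le_mul fun p q => ?_)
    rw [dist_smul₀, Real.norm_of_nonneg ht.1]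
    exact (mul_le_of_le_one_left dist_nonneg ht.2).trans (hl.dist_le_mul p q)
  choose ψ hψ using hD
  refine ⟨ψ, ⟨?_, fun p => ?_, fun t _ p => ?_⟩, ⟨R, fun t p hp => ?_⟩,
    Filter.Eventually.of_forall fun p => ?_⟩
  · have hsmooth : ContDiff ℝ ∞ fun q : ℝ × R3 => q.2 + q.1 • h q.2 :=
      contDiff_snd.add (contDiff_fst.smul (hs.comp contDiff_snd))
    refine contMDiffOn_prod_iff_contDiffOn.2 (hsmooth.contDiffOn.congr fun q hq => ?_)
    rw [hψ, hc _ hq.1]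
  · rw [hψ, hc 0 (by simp), zero_smul, add_zero]
  · rw [hψ, hψ, hu, map_add, map_smul]
  · rw [hψ, hR p hp, smul_zero, add_zero]
  · rw [hψ, hc 1 (by simp), one_smul]

theorem isIsotopyGerm_id : IsIsotopyGerm u id :=
  (isIsotopyGerm_id_add contDiff_const ((LipschitzWith.const 0).weaken zero_le)
    (fun _ => (map_zero u).symm) (R := 0) fun _ _ => rfl).congr (.of_forall fun _ => add_zero _)

theorem exists_forall_norm_fderiv_sub_one_lt_isIsotopyGerm (u : R3 →ₗᵢ[ℝ] R3) :
    ∃ c > 0, ∀ φ : R3 → R3, (∀ᶠ p in 𝓝 0, ContDiffAt ℝ ∞ φ p) →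
      (∀ᶠ p in 𝓝 0, φ (u p) = u (φ p)) → φ 0 = 0 → ‖fderiv ℝ φ 0 - 1‖ < c →
      IsIsotopyGerm u φ := by
  obtain ⟨K, hK⟩ := exists_forall_lipschitzWith_radialCutoff (E := R3)
  set c : NNReal := (2 * (1 + K * 2))⁻¹ with hc
  refine ⟨c, by positivity, fun φ hφ hu h0 hn => ?_⟩
  let k : R3 → R3 := fun p => φ p - p
  have hk_deriv : HasStrictFDerivAt k (fderiv ℝ φ 0 - 1) 0 :=
    (hφ.self_of_nhds.hasStrictFDerivAt (by simp)).sub (hasStrictFDerivAt_id 0)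
  obtain ⟨s, hs, hk_lip⟩ := hk_deriv.exists_lipschitzOnWith_of_nnnorm_lt c hn
  obtain ⟨ε, hε, hball⟩ :=
    exists_ball_three_mul_forall_of_eventually ((hφ.and hu).and hs)
  lift ε to NNReal using hε.le
  have hball₂ : Metric.ball (0 : R3) ((2 * ε : NNReal) : ℝ) ⊆ Metric.ball 0 (3 * ε) :=
    Metric.ball_subset_ball (by push_cast; linarith)
  have hzero : ∀ p : R3, ((2 * ε : NNReal) : ℝ) ≤ ‖p‖ → radialCutoff ε p = 0 := fun p hp =>
    radialCutoff_of_le_norm hε (by simpa using hp)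
  have hχk_lip : LipschitzWith (1 / 2) fun p => radialCutoff ε p • k p := by
    have hε' : ε ≠ 0 := by exact_mod_cast hε.ne'
    have hconst : c * (1 + K * ε⁻¹ * (2 * ε)) = 1 / 2 := by
      rw [hc]
      field_simp
    rw [← hconst]
    exact lipschitzWith_cutoff_smul (hK ε) (abs_radialCutoff_le_one _) hzero
      (hk_lip.mono fun p hp => (hball p (hball₂ hp)).2) (by simp [k, h0])
  have hχk_equivariant : ∀ p, radialCutoff ε (u p) • k (u p) = u (radialCutoff ε p • k p) := by
    intro p
    rw [radialCutoff_linearIsometry, map_smul]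
    by_cases hp : p ∈ Metric.ball 0 (3 * ε : ℝ)
    · simp only [k, (hball p hp).1.2, map_sub]
    · have hp' : ((2 * ε : NNReal) : ℝ) ≤ ‖p‖ := by
        simpa using fun h => hp (hball₂ (mem_ball_zero_iff.2 h))
      rw [hzero p hp', zero_smul, zero_smul]
  refine (isIsotopyGerm_id_add (contDiff_radialCutoff_smul hε fun p hp =>
    (hball p hp).1.1.sub contDiffAt_id) hχk_lip hχk_equivariant
    fun p hp => by rw [hzero p hp, zero_smul]).congr ?_
  filter_upwards [radialCutoff_eventually_eq_one hε] with p hp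
  simp [hp]

theorem eventually_isIsotopyGerm_iff {B : R3 →L[ℝ] R3} (hB : IsUnit B)
    (hBu : Commute B u.toContinuousLinearMap) :
    ∀ᶠ A in 𝓝 B, Commute A u.toContinuousLinearMap →
      (IsIsotopyGerm u B ↔ IsIsotopyGerm u A) := by
  obtain ⟨c, hc, hgerm⟩ := exists_forall_norm_fderiv_sub_one_lt_isIsotopyGerm u
  have hmul : ∀ (A : R3 →L[ℝ] R3) (B : (R3 →L[ℝ] R3)ˣ), Commute A u.toContinuousLinearMap →
      Commute (B : R3 →L[ℝ] R3) u.toContinuousLinearMap → ‖A * Ring.inverse ↑B - 1‖ < c →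
      IsIsotopyGerm u (B : R3 →L[ℝ] R3) → IsIsotopyGerm u A := by
    intro A B hA hB hn hgermB
    rw [Ring.inverse_unit] at hn
    set Q : R3 →L[ℝ] R3 := A * ↑B⁻¹ with hQ
    have hcomm : Commute Q u.toContinuousLinearMap := hA.mul_left hB.units_inv_left
    have h := (hgerm Q (.of_forall fun _ => Q.contDiff.contDiffAt)
      (.of_forall fun p => DFunLike.congr_fun hcomm.eq p) (map_zero Q)
      (by rwa [Q.fderiv])).comp hgermB ((B : R3 →L[ℝ] R3).continuous.tendsto' 0 0 (map_zero _))
    change IsIsotopyGerm u (Q * (B : R3 →L[ℝ] R3)) at h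
    rwa [hQ, Units.inv_mul_cancel_right] at h
  have hinv : ContinuousAt Ring.inverse B := by
    obtain ⟨B, rfl⟩ := hB
    exact NormedRing.inverse_continuousAt B
  have hleft : Filter.Tendsto (fun A => ‖A * Ring.inverse B - 1‖) (𝓝 B) (𝓝 0) := by
    have h : ContinuousAt (fun A => ‖A * Ring.inverse B - 1‖) B := by fun_prop
    simpa [ContinuousAt, Ring.mul_inverse_cancel _ hB] using h
  have hright : Filter.Tendsto (fun A => ‖B * Ring.inverse A - 1‖) (𝓝 B) (𝓝 0) := by
    have h : ContinuousAt (fun A => ‖B * Ring.inverse A - 1‖) B := by fun_prop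
    simpa [ContinuousAt, Ring.mul_inverse_cancel _ hB] using h
  filter_upwards [hleft.eventually_lt_const hc, hright.eventually_lt_const hc,
    Units.isOpen.mem_nhds hB] with A hAB hBA hA hAu
  obtain ⟨A, rfl⟩ := hA
  obtain ⟨B, rfl⟩ := hB
  exact ⟨hmul A B hAu hBu hAB, hmul B A hBu hAu hBA⟩

theorem isIsotopyGerm_of_mem_isPreconnected {S : Set (R3 →L[ℝ] R3)} (hS : IsPreconnected S)
    (hunit : ∀ A ∈ S, IsUnit A) (hcomm : ∀ A ∈ S, Commute A u.toContinuousLinearMap)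
    (hone : 1 ∈ S) {A : R3 →L[ℝ] R3} (hA : A ∈ S) : IsIsotopyGerm u A := by
  refine (hS.induction₂ (fun A B => IsIsotopyGerm u A ↔ IsIsotopyGerm u B) (fun B hB => ?_)
    (fun _ _ _ _ _ _ => Iff.trans) (fun _ _ _ _ => Iff.symm) hone hA).1 isIsotopyGerm_id
  filter_upwards [nhdsWithin_le_nhds (eventually_isIsotopyGerm_iff (hunit B hB) (hcomm B hB)),
    self_mem_nhdsWithin] with A h hA
  exact h (hcomm A hA)

end IsotopyGerm

section LinearPart

theorem isPathConnected_setOf_det_pos :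
    IsPathConnected {M : Matrix (Fin 2) (Fin 2) ℝ | 0 < M.det} := by
  let conformal : ℂ → Matrix (Fin 2) (Fin 2) ℝ := fun w => !![w.re, -w.im; w.im, w.re]
  have hdet_conformal : ∀ w, (conformal w).det = Complex.normSq w := fun w => by
    simp [conformal, Matrix.det_fin_two, Complex.normSq_apply]
  have hconformal : IsPathConnected (conformal '' {0}ᶜ) := by
    refine (isPathConnected_compl_singleton_of_one_lt_rank (by simp) 0).image
      (continuous_matrix fun i j => ?_)
    fin_cases i <;> fin_cases j
    exacts [Complex.continuous_re, Complex.continuous_im.neg,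
      Complex.continuous_im, Complex.continuous_re]
  have hpos : ∀ A ∈ conformal '' {0}ᶜ, 0 < A.det := by
    rintro _ ⟨w, hw, rfl⟩
    rw [hdet_conformal]
    exact Complex.normSq_pos.2 hw
  have hone : (1 : Matrix (Fin 2) (Fin 2) ℝ) ∈ conformal '' {0}ᶜ :=
    ⟨1, one_ne_zero, by ext i j; fin_cases i <;> fin_cases j <;> simp [conformal]⟩
  refine ⟨1, hpos 1 hone, fun {M} hM => ?_⟩
  -- `M` shares its second row with a conformal matrix, and the determinant is linear in the first.
  have hw : (⟨M 1 1, M 1 0⟩ : ℂ) ≠ 0 := fun h => by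
    obtain ⟨h₁₁ : M 1 1 = 0, h₁₀ : M 1 0 = 0⟩ := Complex.ext_iff.1 h
    simp [Matrix.det_fin_two, h₁₁, h₁₀] at hM
  set N := conformal ⟨M 1 1, M 1 0⟩ with hN
  have hN_mem : N ∈ conformal '' {0}ᶜ := ⟨_, hw, rfl⟩
  refine ((hconformal.joinedIn 1 hone N hN_mem).mono hpos).trans (JoinedIn.of_segment_subset ?_)
  rintro _ ⟨a, b, ha, hb, hab, rfl⟩
  have hdet : (a • N + b • M).det = a * N.det + b * M.det := by
    obtain rfl : b = 1 - a := by linarith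
    simp only [hN, conformal, Matrix.det_fin_two, Matrix.add_apply, Matrix.smul_apply,
      Matrix.of_apply, Matrix.cons_val', Matrix.cons_val_zero, Matrix.cons_val_one,
      Matrix.cons_val_fin_one, smul_eq_mul]
    ring
  change 0 < (a • N + b • M).det
  rw [hdet]
  exact (convex_Ioi (0 : ℝ)) (hpos N hN_mem) hM ha hb hab

/-- The involution `rotR3` as a linear isometry. -/
noncomputable def rotIso : R3 ≃ₗᵢ[ℝ] R3 where
  toLinearEquiv := LinearEquiv.ofInvolutive
    { toFun := rotR3
      map_add' := fun p q => by ext i; fin_cases i <;> simp [rotR3] <;> ring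
      map_smul' := fun c p => by ext i; fin_cases i <;> simp [rotR3] }
    fun p => by ext i; fin_cases i <;> simp [rotR3]
  norm_map' := fun p => by
    change ‖rotR3 p‖ = ‖p‖
    simp [EuclideanSpace.norm_eq, rotR3, Fin.sum_univ_three]

theorem rotR3_rotR3 (p : R3) : rotR3 (rotR3 p) = p :=
  rotIso.symm_apply_apply p

/-- The linear map of `ℝ³` that fixes the `x`-axis and acts by a matrix on the `yz`-plane. -/
noncomputable def yzMap : Matrix (Fin 2) (Fin 2) ℝ →* (R3 →L[ℝ] R3) where
  toFun M := LinearMap.toContinuousLinearMap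
    { toFun := fun p => !₂[p 0, M 0 0 * p 1 + M 0 1 * p 2, M 1 0 * p 1 + M 1 1 * p 2]
      map_add' := fun p q => by ext i; fin_cases i <;> simp <;> ring
      map_smul' := fun c p => by ext i; fin_cases i <;> simp <;> ring }
  map_one' := by ext p i; fin_cases i <;> simp
  map_mul' M N := by
    ext p i
    fin_cases i <;> simp [Matrix.mul_apply] <;> ring

theorem yzMap_apply (M : Matrix (Fin 2) (Fin 2) ℝ) (p : R3) :
    yzMap M p = !₂[p 0, M 0 0 * p 1 + M 0 1 * p 2, M 1 0 * p 1 + M 1 1 * p 2] :=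
  rfl

theorem continuous_yzMap : Continuous yzMap := by
  refine continuous_clm_apply.2 fun p => ?_
  simp only [yzMap_apply]
  fun_prop

theorem yzMap_rotR3 (M : Matrix (Fin 2) (Fin 2) ℝ) (p : R3) :
    yzMap M (rotR3 p) = rotR3 (yzMap M p) := by
  ext i
  fin_cases i <;> simp [yzMap_apply, rotR3] <;> ring

theorem isIsotopyGerm_yzMap {M : Matrix (Fin 2) (Fin 2) ℝ} (hM : 0 < M.det) :
    IsIsotopyGerm rotR3 (yzMap M) := by
  refine isIsotopyGerm_of_mem_isPreconnected (u := rotIso.toLinearIsometry)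
    (isPathConnected_setOf_det_pos.image continuous_yzMap).isConnected.isPreconnected
    ?_ ?_ ⟨1, by simp, map_one _⟩ (Set.mem_image_of_mem _ hM)
  · rintro _ ⟨N, hN, rfl⟩
    exact ((Matrix.isUnit_iff_isUnit_det N).2 (isUnit_iff_ne_zero.2 (ne_of_gt hN))).map yzMap
  · rintro _ ⟨N, -, rfl⟩
    exact ContinuousLinearMap.ext (yzMap_rotR3 N)

theorem isIsotopyGerm_of_fderiv_eq_yzMap {φ : R3 → R3} (hφ : ∀ᶠ p in 𝓝 0, ContDiffAt ℝ ∞ φ p)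
    (hu : ∀ᶠ p in 𝓝 0, φ (rotR3 p) = rotR3 (φ p)) (h0 : φ 0 = 0)
    {M : Matrix (Fin 2) (Fin 2) ℝ} (hM : 0 < M.det) (hd : fderiv ℝ φ 0 = yzMap M) :
    IsIsotopyGerm rotR3 φ := by
  have hunit : IsUnit M.det := isUnit_iff_ne_zero.2 hM.ne'
  have htendsto : ∀ N, Filter.Tendsto (yzMap N) (𝓝 0) (𝓝 0) := fun N =>
    (yzMap N).continuous.tendsto' 0 0 (map_zero _)
  obtain ⟨c, hc, hgerm⟩ :=
    exists_forall_norm_fderiv_sub_one_lt_isIsotopyGerm rotIso.toLinearIsometry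
  have hderiv : fderiv ℝ (φ ∘ yzMap M⁻¹) 0 = 1 := by
    have hdiff : DifferentiableAt ℝ φ (yzMap M⁻¹ 0) := by
      rw [map_zero]
      exact hφ.self_of_nhds.differentiableAt (by simp)
    rw [fderiv_comp _ hdiff (yzMap M⁻¹).differentiableAt, ContinuousLinearMap.fderiv, map_zero, hd]
    change yzMap M * yzMap M⁻¹ = 1
    rw [← map_mul, Matrix.mul_nonsing_inv _ hunit, map_one]
  have hcorrected : IsIsotopyGerm rotR3 (φ ∘ yzMap M⁻¹) := by
    refine hgerm _ ?_ ?_ (by simp [h0]) (by simpa [hderiv] using hc)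
    · filter_upwards [(htendsto M⁻¹).eventually hφ] with p hp
      exact hp.comp p (yzMap M⁻¹).contDiff.contDiffAt
    · filter_upwards [(htendsto M⁻¹).eventually hu] with p hp
      exact (congrArg φ (yzMap_rotR3 _ _)).trans hp
  refine (hcorrected.comp (isIsotopyGerm_yzMap hM) (htendsto M)).congr (.of_forall fun p => ?_)
  have hinv : yzMap M⁻¹ (yzMap M p) = p := by
    change (yzMap M⁻¹ * yzMap M) p = p
    rw [← map_mul, Matrix.nonsing_inv_mul _ hunit, map_one]
    rfl
  simp [hinv]

end LinearPart

section Darboux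

/-- The standard basis vectors of `ℝ³`. -/
noncomputable abbrev stdVec (i : Fin 3) : R3 := EuclideanSpace.single i 1

theorem eq_sum_stdVec (v : R3) : v = v 0 • stdVec 0 + v 1 • stdVec 1 + v 2 • stdVec 2 := by
  ext i
  fin_cases i <;> simp

/-- `a` is, near the origin, a smooth 1-form with `rotR3^* a = -a`, and `a ∧ da` is positive at the
origin. -/
structure IsInvariantContactGerm (a : R3 → R3 →L[ℝ] ℝ) : Prop where
  smooth : ∀ᶠ p in 𝓝 0, ContDiffAt ℝ ∞ a p
  odd : ∀ᶠ p in 𝓝 0, ∀ v, a (rotR3 p) (rotR3 v) = -a p v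
  pos : 0 < wedgeExtDeriv a 0

/-- The vector field spanning `ker a ∩ ker dx`. -/
noncomputable def legendrianField (a : R3 → R3 →L[ℝ] ℝ) (p : R3) : R3 :=
  a p (stdVec 2) • stdVec 1 - a p (stdVec 1) • stdVec 2

theorem wedgeExtDeriv_eq_extDerivOne_legendrianField {a : R3 → R3 →L[ℝ] ℝ} {p : R3}
    (h : a p (stdVec 0) = 0) :
    wedgeExtDeriv a p = extDerivOne a p (stdVec 0) (legendrianField a p) := by
  simp only [wedgeExtDeriv, extDerivOne, legendrianField, h, map_sub, map_smul, sub_apply,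
    smul_apply, smul_eq_mul]
  ring

theorem apply_legendrianField (a : R3 → R3 →L[ℝ] ℝ) (p : R3) : a p (legendrianField a p) = 0 := by
  simp only [legendrianField, map_sub, map_smul, smul_eq_mul]
  ring

theorem rotR3_stdVec_zero : rotR3 (stdVec 0) = stdVec 0 := by
  ext i
  fin_cases i <;> simp [rotR3]

theorem rotR3_stdVec_one : rotR3 (stdVec 1) = -stdVec 1 := by
  ext i
  fin_cases i <;> simp [rotR3]

theorem rotR3_stdVec_two : rotR3 (stdVec 2) = -stdVec 2 := by
  ext i
  fin_cases i <;> simp [rotR3]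

theorem legendrianField_rotR3 {a : R3 → R3 →L[ℝ] ℝ} {p : R3}
    (h : ∀ v, a (rotR3 p) (rotR3 v) = -a p v) :
    legendrianField a (rotR3 p) = -rotR3 (legendrianField a p) := by
  have h₁ := h (stdVec 1)
  have h₂ := h (stdVec 2)
  rw [rotR3_stdVec_one, map_neg, neg_inj] at h₁
  rw [rotR3_stdVec_two, map_neg, neg_inj] at h₂
  rw [legendrianField, h₁, h₂]
  ext i
  fin_cases i <;> simp [legendrianField, rotR3]

/-- The coefficient `c` in the expression `G = f dx + c A` of a functional `G` that vanishes on
`ker A ∩ ker dx`; it has the junk value `0` if `A` is a multiple of `dx`. -/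
noncomputable def contactCoeff (A G : R3 →L[ℝ] ℝ) : ℝ :=
  (G (stdVec 1) * A (stdVec 1) + G (stdVec 2) * A (stdVec 2)) /
    (A (stdVec 1) ^ 2 + A (stdVec 2) ^ 2)

theorem eq_smul_proj_add_contactCoeff_smul {A G : R3 →L[ℝ] ℝ}
    (hA : A (stdVec 1) ^ 2 + A (stdVec 2) ^ 2 ≠ 0)
    (hG : G (A (stdVec 2) • stdVec 1 - A (stdVec 1) • stdVec 2) = 0) :
    G = (G (stdVec 0) - contactCoeff A G * A (stdVec 0)) •
      (EuclideanSpace.proj 0 : R3 →L[ℝ] ℝ) + contactCoeff A G • A := by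
  simp only [map_sub, map_smul, smul_eq_mul] at hG
  have h₁ : G (stdVec 1) = contactCoeff A G * A (stdVec 1) := by
    rw [contactCoeff]
    field_simp
    linear_combination A (stdVec 2) * hG
  have h₂ : G (stdVec 2) = contactCoeff A G * A (stdVec 2) := by
    rw [contactCoeff]
    field_simp
    linear_combination -A (stdVec 1) * hG
  ext v
  have hsum (L : R3 →L[ℝ] ℝ) :
      L v = v 0 * L (stdVec 0) + v 1 * L (stdVec 1) + v 2 * L (stdVec 2) := by
    conv_lhs => rw [eq_sum_stdVec v]
    simp only [map_add, map_smul, smul_eq_mul]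
  simp only [add_apply, smul_apply, PiLp.proj_apply, smul_eq_mul]
  rw [hsum G, hsum A, h₁, h₂]
  ring

theorem fderiv_eq_mul_extDerivOne {a : R3 → R3 →L[ℝ] ℝ} {f g c : R3 → ℝ} {θ : R3 →L[ℝ] ℝ} {p : R3}
    (ha : DifferentiableAt ℝ a p) (hf : DifferentiableAt ℝ f p) (hc : DifferentiableAt ℝ c p)
    (hg : ContDiffAt ℝ 2 g p) (h : fderiv ℝ g =ᶠ[𝓝 p] fun q => f q • θ + c q • a q)
    {v w : R3} (hv : a p v = 0) (hw : a p w = 0) (hθv : θ v = 1) (hθw : θ w = 0) :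
    fderiv ℝ f p w = c p * extDerivOne a p v w := by
  have hsymm := hg.isSymmSndFDerivAt (by simp) w v
  have hsnd : fderiv ℝ (fderiv ℝ g) p =
      (fderiv ℝ f p).smulRight θ + (c p • fderiv ℝ a p + (fderiv ℝ c p).smulRight (a p)) :=
    h.fderiv_eq.trans
      ((hf.hasFDerivAt.smul_const θ).add (hc.hasFDerivAt.smul ha.hasFDerivAt)).fderiv
  rw [hsnd] at hsymm
  simp only [add_apply, smul_apply, ContinuousLinearMap.smulRight_apply, smul_eq_mul, hv, hw, hθv,
    hθw, mul_one, mul_zero, add_zero, zero_add] at hsymm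
  rw [extDerivOne]
  linarith

theorem contactCoeff_eq_of_odd {A A' G G' : R3 →L[ℝ] ℝ} (hA : ∀ v, A' (rotR3 v) = -A v)
    (hG : ∀ v, G' (rotR3 v) = -G v) : contactCoeff A' G' = contactCoeff A G := by
  have heven : ∀ {B B' : R3 →L[ℝ] ℝ}, (∀ v, B' (rotR3 v) = -B v) →
      B' (stdVec 1) = B (stdVec 1) ∧ B' (stdVec 2) = B (stdVec 2) := fun h =>
    ⟨by simpa [rotR3_stdVec_one] using h (stdVec 1),
      by simpa [rotR3_stdVec_two] using h (stdVec 2)⟩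
  simp only [contactCoeff, heven hA, heven hG]

theorem fderiv_rotR3_of_odd {g : R3 → ℝ} (hg : ∀ p, g (rotR3 p) = -g p) (p v : R3) :
    fderiv ℝ g (rotR3 p) (rotR3 v) = -fderiv ℝ g p v := by
  have hcomp : g ∘ rotIso.toContinuousLinearEquiv = -g := funext hg
  have h := rotIso.toContinuousLinearEquiv.comp_right_fderiv (f := g) (x := p)
  rw [hcomp, fderiv_neg] at h
  exact (DFunLike.congr_fun h v).symm

/-- Near the origin `dg = f dx + c a`, so that `(x, f, g)` pulls `dz - y dx` back to the multiple
`c a` of `a`. -/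
structure IsContactPotential (a : R3 → R3 →L[ℝ] ℝ) (f g c : R3 → ℝ) : Prop where
  contDiffAt_left : ∀ᶠ p in 𝓝 0, ContDiffAt ℝ ∞ f p
  contDiffAt : ∀ᶠ p in 𝓝 0, ContDiffAt ℝ ∞ g p
  contDiffAt_coeff : ∀ᶠ p in 𝓝 0, ContDiffAt ℝ ∞ c p
  odd_left : ∀ᶠ p in 𝓝 0, f (rotR3 p) = -f p
  odd : ∀ᶠ p in 𝓝 0, g (rotR3 p) = -g p
  coeff_zero : c 0 = 1
  fderiv_eq : ∀ᶠ p in 𝓝 0, fderiv ℝ g p = f p • (EuclideanSpace.proj 0 : R3 →L[ℝ] ℝ) + c p • a p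

namespace IsInvariantContactGerm

variable {a : R3 → R3 →L[ℝ] ℝ}

theorem apply_zero_stdVec_zero (ha : IsInvariantContactGerm a) : a 0 (stdVec 0) = 0 := by
  have h := ha.odd.self_of_nhds (stdVec 0)
  have hrot : rotR3 0 = 0 := map_zero rotIso
  rw [hrot, rotR3_stdVec_zero] at h
  linarith

theorem legendrianField_zero_ne_zero (ha : IsInvariantContactGerm a) : legendrianField a 0 ≠ 0 := by
  intro h
  have hpos := ha.pos
  rw [wedgeExtDeriv_eq_extDerivOne_legendrianField ha.apply_zero_stdVec_zero, h] at hpos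
  simp [extDerivOne] at hpos

theorem eventually_contDiffAt_legendrianField (ha : IsInvariantContactGerm a) :
    ∀ᶠ p in 𝓝 0, ContDiffAt ℝ ∞ (legendrianField a) p := by
  filter_upwards [ha.smooth] with p hp
  exact ((hp.clm_apply contDiffAt_const).smul contDiffAt_const).sub
    ((hp.clm_apply contDiffAt_const).smul contDiffAt_const)

theorem eventually_sq_add_sq_ne_zero (ha : IsInvariantContactGerm a) :
    ∀ᶠ p in 𝓝 0, a p (stdVec 1) ^ 2 + a p (stdVec 2) ^ 2 ≠ 0 := by
  have hcont : ContinuousAt a 0 := ha.smooth.self_of_nhds.continuousAt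
  have hsq : ContinuousAt (fun p => a p (stdVec 1) ^ 2 + a p (stdVec 2) ^ 2) 0 := by fun_prop
  refine hsq.eventually_ne fun h => ha.legendrianField_zero_ne_zero ?_
  have h₁ : a 0 (stdVec 1) = 0 := by nlinarith [sq_nonneg (a 0 (stdVec 1))]
  have h₂ : a 0 (stdVec 2) = 0 := by nlinarith [sq_nonneg (a 0 (stdVec 2))]
  simp [legendrianField, h₁, h₂]

theorem exists_odd_firstIntegral (ha : IsInvariantContactGerm a) :
    ∃ g : R3 → ℝ, fderiv ℝ g 0 = a 0 ∧ (∀ p, g (rotR3 p) = -g p) ∧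
      ∀ᶠ p in 𝓝 0, ContDiffAt ℝ ∞ g p ∧ fderiv ℝ g p (legendrianField a p) = 0 := by
  obtain ⟨V, hV, hVa⟩ := exists_contDiff_eventuallyEq ha.eventually_contDiffAt_legendrianField
  have hrot : Filter.Tendsto rotR3 (𝓝 0) (𝓝 0) := rotIso.continuous.tendsto' 0 0 (map_zero rotIso)
  have hVrot : ∀ᶠ p in 𝓝 0, V (rotR3 p) = -rotR3 (V p) := by
    filter_upwards [hVa, hrot.eventually hVa, ha.odd] with p hp hrp hodd
    rw [hp, hrp, legendrianField_rotR3 hodd]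
  have hodd : ∀ v, a 0 (rotR3 v) = -a 0 v := by
    simpa [show rotR3 0 = 0 from map_zero rotIso] using ha.odd.self_of_nhds
  obtain ⟨g, hg₀, hg, hgV⟩ := _root_.exists_odd_firstIntegral hV
    (by rw [hVa.self_of_nhds]; exact ha.legendrianField_zero_ne_zero)
    (u := rotIso.toContinuousLinearEquiv) rotR3_rotR3 hVrot (ℓ := a 0)
    (by rw [hVa.self_of_nhds, apply_legendrianField]) hodd
  refine ⟨g, hg₀, hg, ?_⟩
  filter_upwards [hgV, hVa] with p hp hVp
  rwa [← hVp]

theorem exists_isContactPotential (ha : IsInvariantContactGerm a) :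
    ∃ f g c, IsContactPotential a f g c := by
  obtain ⟨g, hg₀, hg, hgV⟩ := ha.exists_odd_firstIntegral
  set c : R3 → ℝ := fun p => contactCoeff (a p) (fderiv ℝ g p) with hc
  set f : R3 → ℝ := fun p => fderiv ℝ g p (stdVec 0) - c p * a p (stdVec 0) with hf
  have hc_smooth : ∀ᶠ p in 𝓝 0, ContDiffAt ℝ ∞ c p := by
    filter_upwards [ha.smooth, hgV, ha.eventually_sq_add_sq_ne_zero] with p hap hgp hne
    have hdg : ContDiffAt ℝ ∞ (fderiv ℝ g) p := hgp.1.fderiv_right le_rfl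
    have hA : ∀ i, ContDiffAt ℝ ∞ (fun p => a p (stdVec i)) p := fun i =>
      hap.clm_apply contDiffAt_const
    have hG : ∀ i, ContDiffAt ℝ ∞ (fun p => fderiv ℝ g p (stdVec i)) p := fun i =>
      hdg.clm_apply contDiffAt_const
    exact (((hG 1).mul (hA 1)).add ((hG 2).mul (hA 2))).div
      (((hA 1).pow 2).add ((hA 2).pow 2)) hne
  refine ⟨f, g, c, ?_, hgV.mono fun p hp => hp.1, hc_smooth, ?_, .of_forall hg, ?_, ?_⟩
  · filter_upwards [ha.smooth, hgV, hc_smooth] with p hap hgp hcp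
    exact ((hgp.1.fderiv_right le_rfl).clm_apply contDiffAt_const).sub
      (hcp.mul (hap.clm_apply contDiffAt_const))
  · filter_upwards [ha.odd] with p hp
    have hcp : c (rotR3 p) = c p := contactCoeff_eq_of_odd hp (fderiv_rotR3_of_odd hg p)
    have hdg := fderiv_rotR3_of_odd hg p (stdVec 0)
    have hap := hp (stdVec 0)
    rw [rotR3_stdVec_zero] at hdg hap
    simp only [hf, hcp, hdg, hap]
    ring
  · simp only [hc, hg₀, contactCoeff, ← pow_two]
    exact div_self ha.eventually_sq_add_sq_ne_zero.self_of_nhds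
  · filter_upwards [hgV, ha.eventually_sq_add_sq_ne_zero] with p hp hne
    exact eq_smul_proj_add_contactCoeff_smul hne hp.2

end IsInvariantContactGerm

end Darboux

section DarbouxMap

theorem fderiv_zero_comm_of_eventually_comm {E : Type*} [NormedAddCommGroup E] [NormedSpace ℝ E]
    {φ : E → E} {u : E ≃L[ℝ] E} (h : ∀ᶠ p in 𝓝 0, φ (u p) = u (φ p)) (v : E) :
    fderiv ℝ φ 0 (u v) = u (fderiv ℝ φ 0 v) := by
  have hcomp : fderiv ℝ (φ ∘ u) 0 = fderiv ℝ (u ∘ φ) 0 := Filter.EventuallyEq.fderiv_eq h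
  rw [u.comp_right_fderiv, u.comp_fderiv, map_zero] at hcomp
  exact DFunLike.congr_fun hcomp v

theorem eq_yzMap_of_comm {A : R3 →L[ℝ] R3} (hrot : ∀ v, A (rotR3 v) = rotR3 (A v))
    (hA : ∀ v, A v 0 = v 0) :
    A = yzMap !![A (stdVec 1) 1, A (stdVec 2) 1; A (stdVec 1) 2, A (stdVec 2) 2] := by
  have hx : rotR3 (A (stdVec 0)) = A (stdVec 0) := by rw [← hrot, rotR3_stdVec_zero]
  have hx₁ : A (stdVec 0) 1 = 0 := by
    have h : -A (stdVec 0) 1 = A (stdVec 0) 1 := congrArg (fun p : R3 => p 1) hx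
    linarith
  have hx₂ : A (stdVec 0) 2 = 0 := by
    have h : -A (stdVec 0) 2 = A (stdVec 0) 2 := congrArg (fun p : R3 => p 2) hx
    linarith
  have hsum : ∀ (v : R3) i,
      A v i = v 0 * A (stdVec 0) i + v 1 * A (stdVec 1) i + v 2 * A (stdVec 2) i := fun v i => by
    conv_lhs => rw [eq_sum_stdVec v, map_add, map_add, map_smul, map_smul, map_smul]
    rfl
  ext v i
  fin_cases i
  · exact hA v
  · simp [hsum v 1, hx₁, yzMap_apply, mul_comm]
  · simp [hsum v 2, hx₂, yzMap_apply, mul_comm]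

/-- The map `(x, f, g)` of `ℝ³`, which pulls the standard contact form back to `dg - f dx`. -/
noncomputable def darbouxMap (f g : R3 → ℝ) (p : R3) : R3 := !₂[p 0, f p, g p]

variable {f g : R3 → ℝ} {p : R3}

theorem contDiffAt_darbouxMap (hf : ContDiffAt ℝ ∞ f p) (hg : ContDiffAt ℝ ∞ g p) :
    ContDiffAt ℝ ∞ (darbouxMap f g) p := by
  rw [contDiffAt_euclidean]
  intro i
  fin_cases i
  · exact (EuclideanSpace.proj 0 : R3 →L[ℝ] ℝ).contDiff.contDiffAt
  · exact hf
  · exact hg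

theorem fderiv_darbouxMap_apply (hf : DifferentiableAt ℝ f p) (hg : DifferentiableAt ℝ g p)
    (v : R3) : fderiv ℝ (darbouxMap f g) p v = !₂[v 0, fderiv ℝ f p v, fderiv ℝ g p v] := by
  have hφ : DifferentiableAt ℝ (darbouxMap f g) p := by
    rw [differentiableAt_euclidean]
    intro i
    fin_cases i
    · exact (EuclideanSpace.proj 0 : R3 →L[ℝ] ℝ).differentiableAt
    · exact hf
    · exact hg
  have hcoord : ∀ i, fderiv ℝ (darbouxMap f g) p v i =
      fderiv ℝ (fun q => darbouxMap f g q i) p v := fun i =>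
    (DFunLike.congr_fun
      ((EuclideanSpace.proj i : R3 →L[ℝ] ℝ).hasFDerivAt.comp p hφ.hasFDerivAt).fderiv v).symm
  ext i
  rw [hcoord]
  fin_cases i
  · exact DFunLike.congr_fun (EuclideanSpace.proj 0 : R3 →L[ℝ] ℝ).fderiv v
  · rfl
  · rfl

theorem stdForm_darbouxMap_fderiv (hf : DifferentiableAt ℝ f p) (hg : DifferentiableAt ℝ g p)
    (v : R3) :
    stdForm (darbouxMap f g p) (fderiv ℝ (darbouxMap f g) p v) = fderiv ℝ g p v - f p * v 0 := by
  rw [fderiv_darbouxMap_apply hf hg]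
  rfl

theorem darbouxMap_rotR3 (hf : f (rotR3 p) = -f p) (hg : g (rotR3 p) = -g p) :
    darbouxMap f g (rotR3 p) = rotR3 (darbouxMap f g p) := by
  rw [darbouxMap, hf, hg]
  rfl

end DarbouxMap

namespace IsContactPotential

variable {a : R3 → R3 →L[ℝ] ℝ} {f g c : R3 → ℝ}

theorem left_zero (h : IsContactPotential a f g c) : f 0 = 0 :=
  self_eq_neg.1 ((congrArg f (map_zero rotIso)).symm.trans h.odd_left.self_of_nhds)

theorem zero (h : IsContactPotential a f g c) : g 0 = 0 :=
  self_eq_neg.1 ((congrArg g (map_zero rotIso)).symm.trans h.odd.self_of_nhds)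

theorem darbouxMap_zero (h : IsContactPotential a f g c) : darbouxMap f g 0 = 0 := by
  ext i
  fin_cases i <;> simp [darbouxMap, h.left_zero, h.zero]

theorem jacobian_pos (h : IsContactPotential a f g c) (ha : IsInvariantContactGerm a) :
    0 < fderiv ℝ f 0 (stdVec 1) * fderiv ℝ g 0 (stdVec 2) -
      fderiv ℝ f 0 (stdVec 2) * fderiv ℝ g 0 (stdVec 1) := by
  have hg : fderiv ℝ g 0 = a 0 := by
    simpa [h.left_zero, h.coeff_zero] using h.fderiv_eq.self_of_nhds
  have hV : fderiv ℝ f 0 (legendrianField a 0) = wedgeExtDeriv a 0 := by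
    rw [fderiv_eq_mul_extDerivOne (θ := EuclideanSpace.proj 0) (v := stdVec 0)
      (ha.smooth.self_of_nhds.differentiableAt (by simp))
      (h.contDiffAt_left.self_of_nhds.differentiableAt (by simp))
      (h.contDiffAt_coeff.self_of_nhds.differentiableAt (by simp))
      (h.contDiffAt.self_of_nhds.of_le (WithTop.coe_le_coe.2 le_top)) h.fderiv_eq
      ha.apply_zero_stdVec_zero (apply_legendrianField a 0) (by simp) (by simp [legendrianField]),
      h.coeff_zero, one_mul,
      wedgeExtDeriv_eq_extDerivOne_legendrianField ha.apply_zero_stdVec_zero]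
  rw [hg]
  convert ha.pos using 1
  rw [← hV]
  simp only [legendrianField, map_sub, map_smul, smul_eq_mul]
  ring

theorem isIsotopyGerm_darbouxMap (h : IsContactPotential a f g c) (ha : IsInvariantContactGerm a) :
    IsIsotopyGerm rotR3 (darbouxMap f g) := by
  have hsmooth : ∀ᶠ p in 𝓝 0, ContDiffAt ℝ ∞ (darbouxMap f g) p := by
    filter_upwards [h.contDiffAt_left, h.contDiffAt] with p hf hg
    exact contDiffAt_darbouxMap hf hg
  have hrot : ∀ᶠ p in 𝓝 0, darbouxMap f g (rotR3 p) = rotR3 (darbouxMap f g p) := by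
    filter_upwards [h.odd_left, h.odd] with p hf hg
    exact darbouxMap_rotR3 hf hg
  have hderiv : ∀ v, fderiv ℝ (darbouxMap f g) 0 v =
      !₂[v 0, fderiv ℝ f 0 v, fderiv ℝ g 0 v] :=
    fderiv_darbouxMap_apply (h.contDiffAt_left.self_of_nhds.differentiableAt (by simp))
      (h.contDiffAt.self_of_nhds.differentiableAt (by simp))
  have hderiv_rot : ∀ v, fderiv ℝ (darbouxMap f g) 0 (rotR3 v) =
      rotR3 (fderiv ℝ (darbouxMap f g) 0 v) :=
    fderiv_zero_comm_of_eventually_comm (u := rotIso.toContinuousLinearEquiv) hrot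
  refine isIsotopyGerm_of_fderiv_eq_yzMap hsmooth hrot h.darbouxMap_zero ?_
    (eq_yzMap_of_comm hderiv_rot fun v => by simp [hderiv])
  simpa [Matrix.det_fin_two, hderiv] using h.jacobian_pos ha

end IsContactPotential

theorem IsInvariantContactGerm.exists_isIsotopyGerm {a : R3 → R3 →L[ℝ] ℝ}
    (ha : IsInvariantContactGerm a) :
    ∃ (φ : R3 → R3) (c : R3 → ℝ), IsIsotopyGerm rotR3 φ ∧ φ 0 = 0 ∧
      ∀ᶠ p in 𝓝 0, c p ≠ 0 ∧ ∀ v, stdForm (φ p) (fderiv ℝ φ p v) = c p * a p v := by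
  obtain ⟨f, g, c, h⟩ := ha.exists_isContactPotential
  refine ⟨darbouxMap f g, c, h.isIsotopyGerm_darbouxMap ha, h.darbouxMap_zero, ?_⟩
  have hc : ∀ᶠ p in 𝓝 0, c p ≠ 0 :=
    h.contDiffAt_coeff.self_of_nhds.continuousAt.eventually_ne (by simp [h.coeff_zero])
  filter_upwards [hc, h.contDiffAt_left, h.contDiffAt, h.fderiv_eq] with p hcp hf hg hdg
  refine ⟨hcp, fun v => ?_⟩
  rw [stdForm_darbouxMap_fderiv (hf.differentiableAt (by simp)) (hg.differentiableAt (by simp)),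
    hdg]
  simp

section Pullback

variable {M N N' : Type*} [TopologicalSpace M] [ChartedSpace R3 M]
  [TopologicalSpace N] [ChartedSpace R3 N] [TopologicalSpace N'] [ChartedSpace R3 N']

theorem OneForm.pullback_id (α : OneForm M) : OneForm.pullback id α = α := by
  funext p
  rw [OneForm.pullback, mfderiv_id]
  rfl

theorem OneForm.pullback_pullback {f : M → N} {g : N → N'} (hg : MDifferentiable (𝓡 3) (𝓡 3) g)
    (hf : MDifferentiable (𝓡 3) (𝓡 3) f) (α : OneForm N') :
    OneForm.pullback f (OneForm.pullback g α) = OneForm.pullback (g ∘ f) α := by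
  funext p
  simp only [OneForm.pullback, mfderiv_comp p (hg (f p)) (hf p)]
  rfl

theorem TangentField.pullback_id (ξ : TangentField M) : TangentField.pullback id ξ = ξ := by
  funext p
  rw [TangentField.pullback, mfderiv_id]
  rfl

theorem TangentField.pullback_pullback {f : M → N} {g : N → N'}
    (hg : MDifferentiable (𝓡 3) (𝓡 3) g) (hf : MDifferentiable (𝓡 3) (𝓡 3) f)
    (ξ : TangentField N') :
    TangentField.pullback f (TangentField.pullback g ξ) = TangentField.pullback (g ∘ f) ξ := by
  funext p
  simp only [TangentField.pullback, mfderiv_comp p (hg (f p)) (hf p)]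
  rfl

theorem TangentField.pushforward_apply_eq {ψ : M ≃ₘ^∞⟮𝓡 3, 𝓡 3⟯ N} {ξ : TangentField M}
    {η : TangentField N} {q : N}
    (h : ξ (ψ.symm q) = TangentField.pullback ψ η (ψ.symm q)) :
    TangentField.pushforward ψ ξ q = η q := by
  rw [TangentField.pushforward, TangentField.pullback, h]
  change TangentField.pullback ψ.symm (TangentField.pullback ψ η) q = η q
  rw [TangentField.pullback_pullback (ψ.contMDiff.mdifferentiable (by simp))
    (ψ.symm.contMDiff.mdifferentiable (by simp)),
    show ψ ∘ ψ.symm = id from funext ψ.apply_symm_apply, TangentField.pullback_id]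

end Pullback

theorem eventually_pushforward_ker_eq {a b : OneForm R3} {φ : R3 → R3} {c : R3 → ℝ} (h0 : φ 0 = 0)
    (hφ : ∀ᶠ p in 𝓝 0, c p ≠ 0 ∧ ∀ v : R3, b (φ p) (fderiv ℝ φ p v) = c p * a p v)
    {ψ : R3 ≃ₘ^∞⟮𝓡 3, 𝓡 3⟯ R3} (hψ : ψ =ᶠ[𝓝 0] φ) :
    ∀ᶠ p in 𝓝 (0 : R3), TangentField.pushforward ψ (OneForm.ker a) p = OneForm.ker b p := by
  have hψ0 : ψ.symm 0 = 0 := by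
    rw [← (hψ.self_of_nhds.trans h0 : ψ 0 = 0), ψ.symm_apply_apply, hψ.self_of_nhds, h0]
  have hker : ∀ᶠ p in 𝓝 (0 : R3),
      OneForm.ker a p = TangentField.pullback ψ (OneForm.ker b) p := by
    filter_upwards [hφ, hψ.eventually_nhds] with p ⟨hc, hp⟩ hψp
    have hpull : ∀ v : R3, b (ψ p) (mfderiv (𝓡 3) (𝓡 3) ψ p v) = c p * a p v := fun v => by
      rw [mfderiv_eq_fderiv, Filter.EventuallyEq.fderiv_eq hψp, hψp.self_of_nhds]
      exact hp v
    ext v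
    change a p v = 0 ↔ b (ψ p) (mfderiv (𝓡 3) (𝓡 3) ψ p v) = 0
    exact ((Eq.congr_left (hpull v)).trans (mul_eq_zero_iff_left hc)).symm
  filter_upwards [(ψ.symm.continuous.tendsto' 0 0 hψ0).eventually hker] with q hq
  exact TangentField.pushforward_apply_eq hq

theorem IsInvariantContactGerm.exists_isotopy {a : OneForm R3} (ha : IsInvariantContactGerm a) :
    ∃ ψ : ℝ → R3 ≃ₘ^∞⟮𝓡 3, 𝓡 3⟯ R3, IsEquivariantIsotopy rotR3 ψ ∧
      (∃ R : ℝ, ∀ t p, R ≤ ‖p‖ → ψ t p = p) ∧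
      ∀ᶠ p in 𝓝 (0 : R3),
        TangentField.pushforward (ψ 1) (OneForm.ker a) p = OneForm.ker stdForm p := by
  obtain ⟨φ, c, ⟨ψ, hψ, hsupp, hφψ⟩, h0, hφ⟩ := ha.exists_isIsotopyGerm
  exact ⟨ψ, hψ, hsupp, eventually_pushforward_ker_eq h0 hφ hφψ⟩

theorem mfderiv_rotR3 (p v : R3) : mfderiv (𝓡 3) (𝓡 3) rotR3 p v = rotR3 v := by
  rw [mfderiv_eq_fderiv]
  exact DFunLike.congr_fun rotIso.toContinuousLinearEquiv.fderiv v

theorem IsInvariantContactStructure.exists_isInvariantContactGerm_pullback {M : Type*}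
    [TopologicalSpace M] [ChartedSpace R3 M] {P : Set (R3 → M)} {u : M → M} {ξ : TangentField M}
    (hξ : IsInvariantContactStructure P u ξ) {σ : R3 → M} (hσ : σ ∈ P)
    (hσ_diff : MDifferentiable (𝓡 3) (𝓡 3) σ) (hu : MDifferentiable (𝓡 3) (𝓡 3) u)
    (hσu : ∀ p, σ (rotR3 p) = u (σ p)) :
    ∃ α : OneForm M, ξ = OneForm.ker α ∧ IsInvariantContactGerm (OneForm.pullback σ α) := by
  obtain ⟨-, α, hα, rfl, hodd⟩ := hξ
  have hrot : MDifferentiable (𝓡 3) (𝓡 3) rotR3 :=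
    rotIso.toContinuousLinearEquiv.differentiable.mdifferentiable
  have hpull : ∀ p, OneForm.pullback rotR3 (OneForm.pullback σ α) p = -OneForm.pullback σ α p := by
    intro p
    rw [OneForm.pullback_pullback hσ_diff hrot, show σ ∘ rotR3 = u ∘ σ from funext hσu,
      ← OneForm.pullback_pullback hu hσ_diff, OneForm.pullback, hodd]
    rfl
  refine ⟨α, rfl, .of_forall fun p => (hα σ hσ).1.contDiffAt, .of_forall fun p v => ?_,
    (hα σ hσ).2 0⟩
  rw [← mfderiv_rotR3 p v]
  exact DFunLike.congr_fun (hpull p) v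

section Sphere

theorem contMDiff_coe_S3 :
    ContMDiff (𝓡 3) 𝓘(ℝ, EuclideanSpace ℝ (Fin 4)) ∞ (Subtype.val : S3 → _) :=
  haveI : Fact (Module.finrank ℝ (EuclideanSpace ℝ (Fin 4)) = 3 + 1) :=
    ⟨finrank_euclideanSpace_fin⟩
  contMDiff_coe_sphere

theorem contMDiff_S3_of_coe {M : Type*} [TopologicalSpace M] [ChartedSpace R3 M]
    [IsManifold (𝓡 3) ∞ M] {f : M → S3}
    (hf : ContMDiff (𝓡 3) 𝓘(ℝ, EuclideanSpace ℝ (Fin 4)) ∞ fun p => (f p).1) :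
    ContMDiff (𝓡 3) (𝓡 3) ∞ f :=
  haveI : Fact (Module.finrank ℝ (EuclideanSpace ℝ (Fin 4)) = 3 + 1) :=
    ⟨finrank_euclideanSpace_fin⟩
  hf.codRestrict_sphere fun p => (f p).2

theorem contMDiff_stereoInv : ContMDiff (𝓡 3) (𝓡 3) ∞ stereoInv := by
  refine contMDiff_S3_of_coe (contMDiff_iff_contDiff.2 (contDiff_euclidean.2 fun i => ?_))
  have hcoord : ∀ i : Fin 3, ContDiff ℝ ∞ fun p : R3 => p i := fun i => by fun_prop
  have hden : ContDiff ℝ ∞ fun p : R3 => p 0 ^ 2 + p 1 ^ 2 + p 2 ^ 2 + 1 := by fun_prop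
  have hden_ne : ∀ p : R3, p 0 ^ 2 + p 1 ^ 2 + p 2 ^ 2 + 1 ≠ 0 := fun p => by positivity
  have hnum : ContDiff ℝ ∞ fun p : R3 => p 0 ^ 2 + p 1 ^ 2 + p 2 ^ 2 - 1 := by fun_prop
  fin_cases i
  · exact (contDiff_const.mul (hcoord 0)).div hden hden_ne
  · exact (contDiff_const.mul (hcoord 1)).div hden hden_ne
  · exact (contDiff_const.mul (hcoord 2)).div hden hden_ne
  · exact hnum.div hden hden_ne

theorem contMDiff_rotS3 : ContMDiff (𝓡 3) (𝓡 3) ∞ rotS3 := by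
  have hrot : ContDiff ℝ ∞ fun x : EuclideanSpace ℝ (Fin 4) =>
      (!₂[x 0, -x 1, -x 2, x 3] : EuclideanSpace ℝ (Fin 4)) := by
    have hcoord : ∀ i : Fin 4, ContDiff ℝ ∞ fun x : EuclideanSpace ℝ (Fin 4) => x i :=
      fun i => by fun_prop
    rw [contDiff_euclidean]
    intro i
    fin_cases i
    · exact hcoord 0
    · exact (hcoord 1).neg
    · exact (hcoord 2).neg
    · exact hcoord 3
  exact contMDiff_S3_of_coe (hrot.contMDiff.comp contMDiff_coe_S3)

/-- Stereographic projection from `∞ = (0, 0, 0, 1)`, with the junk value `0` at `∞`. -/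
noncomputable def stereoProj (q : S3) : R3 :=
  !₂[q.1 0 / (1 - q.1 3), q.1 1 / (1 - q.1 3), q.1 2 / (1 - q.1 3)]

theorem stereoProj_stereoInv (p : R3) : stereoProj (stereoInv p) = p := by
  have h : p 0 ^ 2 + p 1 ^ 2 + p 2 ^ 2 + 1 ≠ 0 := by positivity
  have hpole : 1 - (p 0 ^ 2 + p 1 ^ 2 + p 2 ^ 2 - 1) / (p 0 ^ 2 + p 1 ^ 2 + p 2 ^ 2 + 1) =
      2 / (p 0 ^ 2 + p 1 ^ 2 + p 2 ^ 2 + 1) := by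
    field_simp
    ring
  ext i
  fin_cases i <;> simp [stereoProj, stereoInv, hpole] <;> field_simp

theorem stereoInv_three_ne (p : R3) : (stereoInv p).1 3 ≠ 1 := by
  have h : p 0 ^ 2 + p 1 ^ 2 + p 2 ^ 2 + 1 ≠ 0 := by positivity
  change (p 0 ^ 2 + p 1 ^ 2 + p 2 ^ 2 - 1) / (p 0 ^ 2 + p 1 ^ 2 + p 2 ^ 2 + 1) ≠ 1
  rw [Ne, div_eq_one_iff_eq h]
  linarith

theorem sum_sq_stereoProj {q : S3} (hq : q.1 3 ≠ 1) :
    stereoProj q 0 ^ 2 + stereoProj q 1 ^ 2 + stereoProj q 2 ^ 2 =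
      (1 + q.1 3) / (1 - q.1 3) := by
  have h := (mem_S3_iff q.1).1 q.2
  have hden : 1 - q.1 3 ≠ 0 := sub_ne_zero.2 hq.symm
  change (q.1 0 / (1 - q.1 3)) ^ 2 + (q.1 1 / (1 - q.1 3)) ^ 2 + (q.1 2 / (1 - q.1 3)) ^ 2 = _
  field_simp
  linear_combination h

theorem stereoInv_stereoProj {q : S3} (hq : q.1 3 ≠ 1) : stereoInv (stereoProj q) = q := by
  have hden : 1 - q.1 3 ≠ 0 := sub_ne_zero.2 hq.symm
  have hsum : (1 + q.1 3) / (1 - q.1 3) + 1 = 2 / (1 - q.1 3) := by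
    field_simp
    ring
  refine Subtype.ext ?_
  simp only [stereoInv, sum_sq_stereoProj hq, hsum]
  ext i
  fin_cases i <;> simp [stereoProj] <;> field_simp
  ring

theorem eventually_le_norm_stereoProj {q₀ : S3} (hq₀ : q₀.1 3 = 1) (R : ℝ) :
    ∀ᶠ q : S3 in 𝓝 q₀, q.1 3 ≠ 1 → R ≤ ‖stereoProj q‖ := by
  have hcont : Continuous fun q : S3 => 1 + q.1 3 - R ^ 2 * (1 - q.1 3) := by fun_prop
  have hpos : 0 < 1 + q₀.1 3 - R ^ 2 * (1 - q₀.1 3) := by norm_num [hq₀]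
  filter_upwards [hcont.continuousAt.eventually (lt_mem_nhds hpos)] with q hR hq
  have hle : q.1 3 ≤ 1 := by
    nlinarith [(mem_S3_iff q.1).1 q.2, sq_nonneg (q.1 0), sq_nonneg (q.1 1), sq_nonneg (q.1 2)]
  have hden : 0 < 1 - q.1 3 := sub_pos.2 (lt_of_le_of_ne hle hq)
  have hnorm : ‖stereoProj q‖ ^ 2 = (1 + q.1 3) / (1 - q.1 3) := by
    rw [EuclideanSpace.real_norm_sq_eq, Fin.sum_univ_three, sum_sq_stereoProj hq]
  refine le_of_sq_le_sq ?_ (norm_nonneg _)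
  rw [hnorm, le_div_iff₀ hden]
  linarith

theorem contMDiffAt_stereoProj {q : S3} (hq : q.1 3 ≠ 1) :
    ContMDiffAt (𝓡 3) (𝓡 3) ∞ stereoProj q := by
  have hden : 1 - q.1 3 ≠ 0 := sub_ne_zero.2 hq.symm
  have hproj : ContDiffAt ℝ ∞ (fun x : EuclideanSpace ℝ (Fin 4) =>
      (!₂[x 0 / (1 - x 3), x 1 / (1 - x 3), x 2 / (1 - x 3)] : R3)) q.1 := by
    have hcoord : ∀ i : Fin 4, ContDiffAt ℝ ∞ (fun x : EuclideanSpace ℝ (Fin 4) => x i) q.1 :=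
      fun i => by fun_prop
    rw [contDiffAt_euclidean]
    intro i
    fin_cases i
    · exact (hcoord 0).div (contDiffAt_const.sub (hcoord 3)) hden
    · exact (hcoord 1).div (contDiffAt_const.sub (hcoord 3)) hden
    · exact (hcoord 2).div (contDiffAt_const.sub (hcoord 3)) hden
  exact hproj.contMDiffAt.comp q contMDiff_coe_S3.contMDiffAt

theorem stereoInv_rotR3 (p : R3) : stereoInv (rotR3 p) = rotS3 (stereoInv p) := by
  refine Subtype.ext ?_
  ext i
  fin_cases i <;> simp [stereoInv, rotS3, rotR3] <;> ring

theorem stereoProj_rotS3 (q : S3) : stereoProj (rotS3 q) = rotR3 (stereoProj q) := by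
  ext i
  fin_cases i <;> simp [stereoProj, rotS3, rotR3, neg_div]

open Classical in
/-- The extension of a self-map of `ℝ³` to `S³ = ℝ³ ∪ {∞}` fixing `∞`. -/
noncomputable def sphereExtend (f : R3 → R3) (q : S3) : S3 :=
  if q.1 3 = 1 then q else stereoInv (f (stereoProj q))

theorem sphereExtend_of_ne (f : R3 → R3) {q : S3} (hq : q.1 3 ≠ 1) :
    sphereExtend f q = stereoInv (f (stereoProj q)) := if_neg hq

theorem sphereExtend_of_eq (f : R3 → R3) {q : S3} (hq : q.1 3 = 1) : sphereExtend f q = q :=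
  if_pos hq

theorem sphereExtend_stereoInv (f : R3 → R3) (p : R3) :
    sphereExtend f (stereoInv p) = stereoInv (f p) := by
  rw [sphereExtend_of_ne f (stereoInv_three_ne p), stereoProj_stereoInv]

theorem sphereExtend_eq_self {f : R3 → R3} {q : S3}
    (h : q.1 3 ≠ 1 → f (stereoProj q) = stereoProj q) : sphereExtend f q = q := by
  by_cases hq : q.1 3 = 1
  · exact sphereExtend_of_eq f hq
  · rw [sphereExtend_of_ne f hq, h hq, stereoInv_stereoProj hq]

theorem sphereExtend_leftInverse {f g : R3 → R3} (h : Function.LeftInverse f g) :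
    Function.LeftInverse (sphereExtend f) (sphereExtend g) := by
  intro q
  by_cases hq : q.1 3 = 1
  · rw [sphereExtend_of_eq g hq, sphereExtend_of_eq f hq]
  · rw [sphereExtend_of_ne g hq, sphereExtend_stereoInv, h, stereoInv_stereoProj hq]

theorem sphereExtend_rotS3 {f : R3 → R3} (h : ∀ p, f (rotR3 p) = rotR3 (f p)) (q : S3) :
    sphereExtend f (rotS3 q) = rotS3 (sphereExtend f q) := by
  have hpole : (rotS3 q).1 3 = q.1 3 := rfl
  by_cases hq : q.1 3 = 1
  · rw [sphereExtend_of_eq f hq, sphereExtend_of_eq f (hpole.trans hq)]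
  · rw [sphereExtend_of_ne f hq, sphereExtend_of_ne f (hpole ▸ hq), stereoProj_rotS3, h,
      stereoInv_rotR3]

theorem contMDiffOn_sphereExtend {f : ℝ → R3 → R3} {s : Set ℝ}
    (hf : ContMDiffOn (𝓘(ℝ, ℝ).prod (𝓡 3)) (𝓡 3) ∞ (fun q : ℝ × R3 => f q.1 q.2)
      (s ×ˢ Set.univ)) {R : ℝ} (hR : ∀ t p, R ≤ ‖p‖ → f t p = p) :
    ContMDiffOn (𝓘(ℝ, ℝ).prod (𝓡 3)) (𝓡 3) ∞ (fun q : ℝ × S3 => sphereExtend (f q.1) q.2)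
      (s ×ˢ Set.univ) := by
  rintro ⟨t, q⟩ ht
  by_cases hq : q.1 3 = 1
  · refine (contMDiffWithinAt_snd (n := ∞)).congr_of_eventuallyEq
      (Filter.Eventually.filter_mono nhdsWithin_le_nhds ?_) (sphereExtend_of_eq _ hq)
    filter_upwards [(continuous_snd.tendsto (t, q)).eventually
      (eventually_le_norm_stereoProj hq R)] with x hx
    exact sphereExtend_eq_self fun hpole => hR _ _ (hx hpole)
  · have hne : ∀ᶠ x : ℝ × S3 in 𝓝 (t, q), x.2.1 3 ≠ 1 := by
      have hcont : Continuous fun x : ℝ × S3 => x.2.1 3 := by fun_prop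
      exact hcont.continuousAt.eventually_ne hq
    have hproj : ContMDiffAt (𝓘(ℝ, ℝ).prod (𝓡 3)) (𝓘(ℝ, ℝ).prod (𝓡 3)) ∞
        (fun x : ℝ × S3 => (x.1, stereoProj x.2)) (t, q) :=
      have hstereo : ContMDiffAt (𝓡 3) (𝓡 3) ∞ stereoProj (t, q).2 := contMDiffAt_stereoProj hq
      contMDiffAt_fst.prodMk (hstereo.comp (t, q) contMDiffAt_snd)
    have hfproj : ContMDiffWithinAt (𝓘(ℝ, ℝ).prod (𝓡 3)) (𝓡 3) ∞
        (fun x : ℝ × S3 => f x.1 (stereoProj x.2)) (s ×ˢ Set.univ) (t, q) :=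
      ContMDiffWithinAt.comp (t, q) (hf (t, stereoProj q) ⟨ht.1, Set.mem_univ _⟩)
        hproj.contMDiffWithinAt fun x hx => Set.mk_mem_prod hx.1 (Set.mem_univ _)
    refine (contMDiff_stereoInv.contMDiffAt.comp_contMDiffWithinAt (t, q)
      hfproj).congr_of_eventuallyEq
      (Filter.Eventually.filter_mono nhdsWithin_le_nhds ?_) (sphereExtend_of_ne _ hq)
    filter_upwards [hne] with x hx using sphereExtend_of_ne _ hx

theorem contMDiff_sphereExtend {f : R3 → R3} (hf : ContMDiff (𝓡 3) (𝓡 3) ∞ f) {R : ℝ}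
    (hR : ∀ p, R ≤ ‖p‖ → f p = p) : ContMDiff (𝓡 3) (𝓡 3) ∞ (sphereExtend f) := by
  have h := contMDiffOn_sphereExtend (f := fun _ => f) (s := Set.univ)
    (hf.comp contMDiff_snd).contMDiffOn fun _ => hR
  rw [Set.univ_prod_univ, contMDiffOn_univ] at h
  exact h.comp ((contMDiff_const (c := (0 : ℝ))).prodMk contMDiff_id)

/-- The extension of a compactly supported diffeomorphism of `ℝ³` to `S³`. -/
noncomputable def sphereDiffeomorph (ψ : R3 ≃ₘ^∞⟮𝓡 3, 𝓡 3⟯ R3) {R : ℝ}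
    (hR : ∀ p, R ≤ ‖p‖ → ψ p = p) : S3 ≃ₘ^∞⟮𝓡 3, 𝓡 3⟯ S3 where
  toFun := sphereExtend ψ
  invFun := sphereExtend ψ.symm
  left_inv := sphereExtend_leftInverse ψ.symm_apply_apply
  right_inv := sphereExtend_leftInverse ψ.apply_symm_apply
  contMDiff_toFun := contMDiff_sphereExtend ψ.contMDiff hR
  contMDiff_invFun := contMDiff_sphereExtend ψ.symm.contMDiff fun p hp => by
    conv_lhs => rw [← hR p hp]
    exact ψ.symm_apply_apply p

theorem isEquivariantIsotopy_sphereDiffeomorph {ψ : ℝ → R3 ≃ₘ^∞⟮𝓡 3, 𝓡 3⟯ R3}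
    (hψ : IsEquivariantIsotopy rotR3 ψ) {R : ℝ} (hR : ∀ t p, R ≤ ‖p‖ → ψ t p = p) :
    IsEquivariantIsotopy rotS3 fun t => sphereDiffeomorph (ψ t) (hR t) where
  smooth := contMDiffOn_sphereExtend hψ.smooth hR
  zero _ := sphereExtend_eq_self fun _ => hψ.zero _
  equivariant t ht := sphereExtend_rotS3 (hψ.equivariant t ht)

theorem pullback_stereoInv_pushforward_sphereDiffeomorph (ψ : R3 ≃ₘ^∞⟮𝓡 3, 𝓡 3⟯ R3) {R : ℝ}
    (hR : ∀ p, R ≤ ‖p‖ → ψ p = p) (ξ : TangentField S3) :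
    TangentField.pullback stereoInv (TangentField.pushforward (sphereDiffeomorph ψ hR) ξ) =
      TangentField.pushforward ψ (TangentField.pullback stereoInv ξ) := by
  have hσ : MDifferentiable (𝓡 3) (𝓡 3) stereoInv := contMDiff_stereoInv.mdifferentiable (by simp)
  have hcomm : (sphereDiffeomorph ψ hR).symm ∘ stereoInv = stereoInv ∘ ψ.symm :=
    funext (sphereExtend_stereoInv ψ.symm)
  rw [TangentField.pushforward, TangentField.pushforward,
    TangentField.pullback_pullback
      ((sphereDiffeomorph ψ hR).symm.contMDiff.mdifferentiable (by simp)) hσ,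
    TangentField.pullback_pullback hσ (ψ.symm.contMDiff.mdifferentiable (by simp)), hcomm]

end Sphere

theorem proposition2p5_general :
    (∀ α : OneForm R3, IsInvariantContactGerm α →
      ∃ ψ : ℝ → R3 ≃ₘ^∞⟮𝓡 3, 𝓡 3⟯ R3, IsEquivariantIsotopy rotR3 ψ ∧
        ∀ᶠ p in 𝓝 (0 : R3),
          TangentField.pushforward (ψ 1) (OneForm.ker α) p = OneForm.ker stdForm p) ∧
    (∀ α : OneForm S3, IsInvariantContactGerm (OneForm.pullback stereoInv α) →
      ∃ ψ : ℝ → S3 ≃ₘ^∞⟮𝓡 3, 𝓡 3⟯ S3, IsEquivariantIsotopy rotS3 ψ ∧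
        ∀ᶠ p in 𝓝 (0 : R3),
          TangentField.pullback stereoInv (TangentField.pushforward (ψ 1) (OneForm.ker α)) p =
            OneForm.ker stdForm p) := by
  refine ⟨fun α hα => ?_, fun α hα => ?_⟩
  · obtain ⟨ψ, hψ, -, hker⟩ := hα.exists_isotopy
    exact ⟨ψ, hψ, hker⟩
  · obtain ⟨ψ, hψ, ⟨R, hR⟩, hker⟩ := hα.exists_isotopy
    refine ⟨fun t => sphereDiffeomorph (ψ t) (hR t),
      isEquivariantIsotopy_sphereDiffeomorph hψ hR, ?_⟩
    rw [pullback_stereoInv_pushforward_sphereDiffeomorph]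
    exact hker

theorem IsInvariantContactStructure.exists_isInvariantContactGerm_R3 {ξ : TangentField R3}
    (hξ : IsInvariantContactStructure atlasR3 rotR3 ξ) :
    ∃ α : OneForm R3, ξ = OneForm.ker α ∧ IsInvariantContactGerm α := by
  obtain ⟨α, hker, hα⟩ := hξ.exists_isInvariantContactGerm_pullback (Set.mem_singleton id)
    mdifferentiable_id rotIso.toContinuousLinearEquiv.differentiable.mdifferentiable fun _ => rfl
  exact ⟨α, hker, α.pullback_id ▸ hα⟩

theorem IsInvariantContactStructure.exists_isInvariantContactGerm_S3 {ξ : TangentField S3}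
    (hξ : IsInvariantContactStructure atlasS3 rotS3 ξ) :
    ∃ α : OneForm S3, ξ = OneForm.ker α ∧
      IsInvariantContactGerm (OneForm.pullback stereoInv α) :=
  hξ.exists_isInvariantContactGerm_pullback (Or.inl rfl)
    (contMDiff_stereoInv.mdifferentiable (by simp)) (contMDiff_rotS3.mdifferentiable (by simp))
    stereoInv_rotR3

theorem proposition2p5 :
    (∀ ξ : TangentField R3, IsInvariantContactStructure atlasR3 rotR3 ξ →
      ∃ ψ : ℝ → R3 ≃ₘ^∞⟮𝓡 3, 𝓡 3⟯ R3, IsEquivariantIsotopy rotR3 ψ ∧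
        ∀ᶠ p in 𝓝 (0 : R3), TangentField.pushforward (ψ 1) ξ p = OneForm.ker stdForm p) ∧
    (∀ ξ : TangentField S3, IsInvariantContactStructure atlasS3 rotS3 ξ →
      ∃ ψ : ℝ → S3 ≃ₘ^∞⟮𝓡 3, 𝓡 3⟯ S3, IsEquivariantIsotopy rotS3 ψ ∧
        ∀ᶠ p in 𝓝 (0 : R3),
          TangentField.pullback stereoInv (TangentField.pushforward (ψ 1) ξ) p =
            OneForm.ker stdForm p) := by
  refine ⟨fun ξ hξ => ?_, fun ξ hξ => ?_⟩
  · obtain ⟨α, rfl, hα⟩ := hξ.exists_isInvariantContactGerm_R3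
    exact proposition2p5_general.1 α hα
  · obtain ⟨α, rfl, hα⟩ := hξ.exists_isInvariantContactGerm_S3
    exact proposition2p5_general.2 α hα
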